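/- **Theorem (Safety of AlterBFT).** In the hybrid synchronous model with $n>2f$, no two honest replicas running AlterBFT (with or without the fast commit rule, i.e. FastAlterBFT or plain AlterBFT) ever commit different blocks at the same height. *Model.* There are $n$ replicas, at most $f$ of them faulty (Byzantine), $n>2f$; the others are honest. Time is real-valued; local clocks run at the same speed, and honest replicas act without delay. Let $\Delta_S,\Delta_L>0$. A message broadcast by an honest replica at time $t$ reaches every honest replica by $t+\Delta_S$ if it is small, and by $\max\{t,GST\}+\Delta_L$ if it is large; proposals are large, all other messages are small. Honest replicas start within $\Delta_S$ of each other. Faulty replicas may send anything at any time, except that signatures of honest replicas cannot be forged. A message that is due by the instant at which a timer expires is processed before the expiry. The hash function $id$ on blocks is injective. *Blocks.* A block $b$ has a payload and a field $prev$: the hash of its predecessor, or $nil$ for a first block. A first block has height $1$, and a block whose predecessor has height $k$ has height $k+1$. A block extends itself, its predecessor, and everything its predecessor extends. *Protocol.* Epochs are numbered $0,1,2,\dots$, and every epoch $e$ has a leader $\mathrm{leader}(e)$. A block certificate of epoch $e$ for the hash $h$ consists of votes $\langle \mathrm{VOTE},e,h\rangle$ signed by at least $f+1$ distinct replicas; a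 silence certificate of $e$ consists of messages $\langle \mathrm{SILENCE},e\rangle$ signed by at least $f+1$ distinct replicas; an equivocation certificate of $e$ consists of two votes signed by $\mathrm{leader}(e)$ in epoch $e$ for different hashes. A replica obtains a certificate either from the individual messages or from a message $\langle\mathrm{QUIT\text{-}EPOCH},cert\rangle$. An honest replica $p$ keeps its current epoch $e_p$, a flag telling whether it has voted in $e_p$, a block certificate $lockedBC$ (initially $nil$), for each started epoch a state (active, committed or not-committed), and for each epoch a decision. It applies the following rules to all messages received so far, as soon as they apply. 1. *Starting epoch $e$* (at the beginning $e=0$): set $e_p=e$, not voted, epoch $e$ active, and start a timer $timeoutCertificate(e)$ of length $\Delta_L+4\Delta_S$. If $p=\mathrm{leader}(e)$: propose at once if $e=0$ or $lockedBC$ is of epoch $e-1$; otherwise propose after $2\Delta_S$, if still in epoch $e$. To propose, $p$ broadcasts $\langle\mathrm{PROPOSE},e,b,lockedBC\rangle$, where $b$ has an arbitrary payload and $b.prev$ is the hash certified by $lockedBC$ ($nil$ if $lockedBC=nil$), and its signed vote for $id(b)$; it then counts as having voted. 2. *Voting.* If $p$ has $\langle\mathrm{PROPOSE},e_p,b,BC\rangle$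 and the vote of $\mathrm{leader}(e_p)$ for $id(b)$ in $e_p$, epoch $e_p$ is active, $p$ has not voted in $e_p$, $b$ satisfies a fixed validity predicate, $BC$ is $nil$ or a block certificate, $b.prev$ is the hash certified by $BC$ ($nil$ if $BC=nil$), and either $lockedBC=nil$ or $BC\ne nil$ is of an epoch at least that of $lockedBC$, then $p$ broadcasts its signed vote for $id(b)$ and forwards the leader's vote and the proposal to all. 3. *Block certificate $c$ of epoch $e_p$ for $h$*: set $lockedBC=c$; if $e_p$ is active, start a timer $timeoutCommit(e_p,h)$ of length $2\Delta_S$; broadcast $\langle\mathrm{QUIT\text{-}EPOCH},c\rangle$; start epoch $e_p+1$. *Block certificate $c$ of another epoch*: if $p=\mathrm{leader}(e_p)$ and $lockedBC$ is $nil$ or of a smaller epoch than $c$, set $lockedBC=c$ and broadcast $\langle\mathrm{QUIT\text{-}EPOCH},c\rangle$. 4. *Silence or equivocation certificate of an active epoch $e$*: epoch $e$ becomes not-committed; if $e=e_p$, broadcast the certificate in a $\mathrm{QUIT\text{-}EPOCH}$ message and start a timer $timeoutCommit(e,nil)$ of length $2\Delta_S$; when that expires and still $e_p=e$, start epoch $e+1$.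 5. *Expiry of $timeoutCertificate(e)$*: if $e=e_p$ and $e$ is active, broadcast a signed $\langle\mathrm{SILENCE},e\rangle$. 6. *Regular commit rule.* When $timeoutCommit(e,h)$ with $h\ne nil$ expires and $e$ is active, $e$ becomes committed with decision $h$. 7. *Fast commit rule (only in FastAlterBFT).* When $p$ has votes of all $n$ replicas for the same hash $h$ in an epoch $e$ that is active, $e$ becomes committed with decision $h$. 8. When $p$ has $\langle\mathrm{PROPOSE},e,b,\cdot\rangle$ and the decision of $e$ is $id(b)$, it commits $b$ and all blocks that $b$ extends. The theorem holds also if a block counts as committed by $p$ as soon as it, or a block extending it, has its hash as the decision of some epoch at $p$, even if the decided block has not arrived yet. That is: if honest replicas $p$ and $q$ have committed blocks $b$ and $b'$ of the same height in an execution, then $b=b'$. -/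

import Mathlib

namespace AlterBFT

/-- A block carries a payload and the hash of its predecessor (`none` for a first block). -/
@[ext]
structure Block (P H : Type*) where
  payload : P
  prev : Option H

/-- `Parent hash a b`: the block `b` names `a` as its predecessor. -/
def Parent {P H : Type*} (hash : Block P H → H) (a b : Block P H) : Prop :=
  b.prev = some (hash a)

/-- `Ancestor hash a b`: `b` extends `a`, i.e. `a` is reached from `b` by following
predecessor links (every block extends itself). -/
def Ancestor {P H : Type*} (hash : Block P H → H) : Block P H → Block P H → Prop :=
  Relation.ReflTransGen (Parent hash)

/-- `HasHeight hash b k`: the chain ending in `b` has exactly `k` blocks. -/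
inductive HasHeight {P H : Type*} (hash : Block P H → H) : Block P H → ℕ → Prop
  | first (b : Block P H) (hb : b.prev = none) : HasHeight hash b 1
  | next (a b : Block P H) (k : ℕ) (hab : Parent hash a b) (ha : HasHeight hash a k) :
      HasHeight hash b (k + 1)

/-- The contents that replicas sign. -/
inductive Content (H : Type*)
  | vote (e : ℕ) (h : H)
  | silence (e : ℕ)

/-- A block certificate: votes of the replicas in `signers`, in `epoch`, for the hash `id`. -/
structure BlockCert (n : ℕ) (H : Type*) where
  epoch : ℕ
  id : H
  signers : Finset (Fin n)

inductive Cert (n : ℕ) (H : Type*)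
  /-- votes of distinct replicas for one hash in one epoch -/
  | block (c : BlockCert n H)
  /-- silence messages of distinct replicas for one epoch -/
  | silence (e : ℕ) (signers : Finset (Fin n))
  /-- two votes signed by `l` in epoch `e` -/
  | equiv (l : Fin n) (e : ℕ) (h h' : H)

def Cert.epoch {n : ℕ} {H : Type*} : Cert n H → ℕ
  | .block c => c.epoch
  | .silence e _ => e
  | .equiv _ e _ _ => e

/-- The pairs (signer, signed content) that a block certificate is made of. -/
def BlockCert.sigs {n : ℕ} {H : Type*} (c : BlockCert n H) : Set (Fin n × Content H) :=
  {x | x.1 ∈ c.signers ∧ x.2 = .vote c.epoch c.id}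

/-- The pairs (signer, signed content) that a certificate is made of. -/
def Cert.sigs {n : ℕ} {H : Type*} : Cert n H → Set (Fin n × Content H)
  | .block c => c.sigs
  | .silence e signers => {x | x.1 ∈ signers ∧ x.2 = .silence e}
  | .equiv l e h h' => {(l, .vote e h), (l, .vote e h')}

inductive Msg (n : ℕ) (P H : Type*)
  /-- `⟨PROPOSE, e, b, bc⟩`, not signed -/
  | propose (e : ℕ) (b : Block P H) (bc : Option (BlockCert n H))
  /-- `⟨VOTE, e, h⟩` or `⟨SILENCE, e⟩`, signed by `p` -/
  | signed (p : Fin n) (c : Content H)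
  /-- `⟨QUIT-EPOCH, cert⟩` -/
  | quit (c : Cert n H)

/-- All signatures that occur in a message. -/
def Msg.sigs {n : ℕ} {P H : Type*} : Msg n P H → Set (Fin n × Content H)
  | .propose _ _ bc => {x | ∃ c ∈ bc, x ∈ c.sigs}
  | .signed p c => {(p, c)}
  | .quit c => c.sigs

/-- State of an epoch at a replica (an epoch that was never started has none). -/
inductive Status
  | active
  | committed
  | notCommitted

inductive Timer (H : Type*)
  | epochChange (e : ℕ)
  | certificate (e : ℕ)
  | commit (e : ℕ) (id : Option H)

/-- The data of a system that runs the protocol. -/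
structure System (n : ℕ) (P H : Type*) where
  /-- bound on the number of faulty replicas -/
  f : ℕ
  /-- the replicas that are actually faulty -/
  faulty : Finset (Fin n)
  leader : ℕ → Fin n
  /-- the hash of a block -/
  hash : Block P H → H
  /-- the application's validity predicate -/
  valid : Block P H → Prop
  /-- delay bound for small messages -/
  ΔS : ℝ
  /-- delay bound for large messages after stabilization -/
  ΔL : ℝ
  /-- global stabilization time -/
  GST : ℝ
  /-- the time at which an honest replica begins the execution -/
  start : Fin n → ℝ
  /-- whether the fast commit rule is part of the protocol (`FastAlterBFT`) or not -/
  fast : Prop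

/-- The local state of a replica; `log` holds the messages received so far, `timers` the running
timers with their expiry times, `ledger` the blocks handed over by `CommitBlock`. -/
structure Local (n : ℕ) (P H : Type*) where
  booted : Prop
  epoch : ℕ
  hasVoted : Prop
  locked : Option (BlockCert n H)
  status : ℕ → Option Status
  decision : ℕ → Option H
  log : Set (Msg n P H)
  timers : Set (Timer H × ℝ)
  ledger : Set (Block P H)

def Local.initial (n : ℕ) (P H : Type*) : Local n P H where
  booted := False
  epoch := 0
  hasVoted := False
  locked := none
  status := fun _ => none
  decision := fun _ => none
  log := ∅
  timers := ∅
  ledger := ∅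

namespace System

variable {n : ℕ} {P H : Type*}

def Honest (S : System n P H) (p : Fin n) : Prop := p ∉ S.faulty

/-- The time by which a message that an honest replica broadcasts at time `t` reaches every honest
replica. Proposals carry blocks and are large; all other messages are small. -/
def deadline (S : System n P H) : Msg n P H → ℝ → ℝ
  | .propose _ _ _, t => max t S.GST + S.ΔL
  | .signed _ _, t => t + S.ΔS
  | .quit _, t => t + S.ΔS

def ValidBlockCert (S : System n P H) (c : BlockCert n H) : Prop := S.f + 1 ≤ c.signers.card

/-- The replica has a block certificate, from a `QUIT-EPOCH` message or from single votes. -/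
def HasBlockCert (S : System n P H) (log : Set (Msg n P H)) (c : BlockCert n H) : Prop :=
  S.ValidBlockCert c ∧
    (.quit (.block c) ∈ log ∨ ∀ q ∈ c.signers, .signed q (.vote c.epoch c.id) ∈ log)

/-- Well-formed silence and equivocation certificates. -/
def ValidMisbehavior (S : System n P H) : Cert n H → Prop
  | .block _ => False
  | .silence _ signers => S.f + 1 ≤ signers.card
  | .equiv l e h h' => l = S.leader e ∧ h ≠ h'

/-- The replica has a silence or equivocation certificate, from a `QUIT-EPOCH` message or from
the single messages that it consists of. -/
def HasMisbehavior (S : System n P H) (log : Set (Msg n P H)) (c : Cert n H) : Prop :=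
  S.ValidMisbehavior c ∧ (.quit c ∈ log ∨ ∀ x ∈ c.sigs, .signed x.1 x.2 ∈ log)

/-- The block that a leader in state `s` proposes with payload `pl`. -/
def newBlock (s : Local n P H) (pl : P) : Block P H where
  payload := pl
  prev := s.locked.map BlockCert.id

/-- The messages that `Propose()` broadcasts. -/
def proposal (S : System n P H) (p : Fin n) (s : Local n P H) (pl : P) : List (Msg n P H) :=
  [.propose s.epoch (newBlock s pl) s.locked,
    .signed p (.vote s.epoch (S.hash (newBlock s pl)))]

/-- The assignments at the beginning of `StartEpoch(e)`, and the start of `timeoutCertificate`. -/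
def enter (S : System n P H) (now : ℝ) (e : ℕ) (s : Local n P H) : Local n P H :=
  { s with
    epoch := e
    hasVoted := False
    status := Function.update s.status e (some .active)
    decision := Function.update s.decision e none
    timers := insert (.certificate e, now + (S.ΔL + 4 * S.ΔS)) s.timers }

/-- The leader of epoch `e` need not wait before it proposes. -/
def ProposesAtOnce (s : Local n P H) (e : ℕ) : Prop :=
  e = 0 ∨ ∃ c, s.locked = some c ∧ c.epoch + 1 = e

/-- `S.StartEpoch p now e s s' out`: executing `StartEpoch(e)` at time `now` may lead replica `p`
from `s` to `s'` and broadcasts `out`. -/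
inductive StartEpoch (S : System n P H) (p : Fin n) (now : ℝ) (e : ℕ) (s : Local n P H) :
    Local n P H → List (Msg n P H) → Prop
  | follower (hp : S.leader e ≠ p) : StartEpoch S p now e s (S.enter now e s) []
  | propose (hp : S.leader e = p) (hs : ProposesAtOnce s e) (pl : P) :
      StartEpoch S p now e s { S.enter now e s with hasVoted := True }
        (S.proposal p (S.enter now e s) pl)
  | wait (hp : S.leader e = p) (hs : ¬ ProposesAtOnce s e) :
      StartEpoch S p now e s
        { S.enter now e s with
          timers := insert (.epochChange e, now + 2 * S.ΔS) (S.enter now e s).timers } []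

/-- A proposal with block `b` and certificate `bc` is acceptable: the block is valid, its
predecessor is the block certified by `bc`, and `bc` is at least as recent as the lock. -/
def Accepts (S : System n P H) (s : Local n P H) (b : Block P H)
    (bc : Option (BlockCert n H)) : Prop :=
  S.valid b ∧ (∀ c ∈ bc, S.ValidBlockCert c) ∧ b.prev = bc.map BlockCert.id ∧
    (s.locked = none ∨ ∃ l c, s.locked = some l ∧ bc = some c ∧ l.epoch ≤ c.epoch)

/-- The rules of an honest replica that are triggered by received messages:
`S.MsgStep p now s s' out` leads from `s` to `s'` and broadcasts `out`. Rules are evaluated on the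
whole log, so a message that arrives early is used as soon as its rule applies. -/
inductive MsgStep (S : System n P H) (p : Fin n) (now : ℝ) (s : Local n P H) :
    Local n P H → List (Msg n P H) → Prop
  /-- vote for the proposal; forward the leader's vote and the proposal -/
  | vote (b : Block P H) (bc : Option (BlockCert n H))
      (hprop : .propose s.epoch b bc ∈ s.log)
      (hlead : .signed (S.leader s.epoch) (.vote s.epoch (S.hash b)) ∈ s.log)
      (hact : s.status s.epoch = some .active) (hvote : ¬ s.hasVoted) (hacc : S.Accepts s b bc) :
      MsgStep S p now s { s with hasVoted := True }
        [.signed p (.vote s.epoch (S.hash b)),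
          .signed (S.leader s.epoch) (.vote s.epoch (S.hash b)),
          .propose s.epoch b bc]
  /-- block certificate of the current epoch, received while the epoch is active -/
  | blockCertActive (c : BlockCert n H) (hc : S.HasBlockCert s.log c) (he : c.epoch = s.epoch)
      (hact : s.status s.epoch = some .active) (s' : Local n P H) (out : List (Msg n P H))
      (hstart : S.StartEpoch p now (s.epoch + 1)
        { s with
          locked := some c
          timers := insert (.commit s.epoch (some c.id), now + 2 * S.ΔS) s.timers } s' out) :
      MsgStep S p now s s' (.quit (.block c) :: out)
  /-- block certificate of the current epoch, received when the epoch is no longer active -/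
  | blockCertInactive (c : BlockCert n H) (hc : S.HasBlockCert s.log c) (he : c.epoch = s.epoch)
      (hact : s.status s.epoch ≠ some .active) (s' : Local n P H) (out : List (Msg n P H))
      (hstart : S.StartEpoch p now (s.epoch + 1) { s with locked := some c } s' out) :
      MsgStep S p now s s' (.quit (.block c) :: out)
  /-- the leader learns a more recent block certificate of another epoch -/
  | blockCertLeader (c : BlockCert n H) (hc : S.HasBlockCert s.log c) (he : c.epoch ≠ s.epoch)
      (hp : S.leader s.epoch = p) (hl : ∀ l, s.locked = some l → l.epoch < c.epoch) :
      MsgStep S p now s { s with locked := some c } [.quit (.block c)]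
  /-- fast commit rule: votes from all replicas -/
  | fastCommit (hfast : S.fast) (e : ℕ) (h : H) (hall : ∀ q, .signed q (.vote e h) ∈ s.log)
      (hact : s.status e = some .active) :
      MsgStep S p now s
        { s with
          status := Function.update s.status e (some .committed)
          decision := Function.update s.decision e (some h) } []
  /-- silence or equivocation certificate of the current epoch -/
  | misbehaviorCurrent (c : Cert n H) (hc : S.HasMisbehavior s.log c) (he : c.epoch = s.epoch)
      (hact : s.status c.epoch = some .active) :
      MsgStep S p now s
        { s with
          status := Function.update s.status c.epoch (some .notCommitted)
          timers := insert (.commit s.epoch none, now + 2 * S.ΔS) s.timers }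
        [.quit c]
  /-- silence or equivocation certificate of another epoch that is still active -/
  | misbehaviorOther (c : Cert n H) (hc : S.HasMisbehavior s.log c) (he : c.epoch ≠ s.epoch)
      (hact : s.status c.epoch = some .active) :
      MsgStep S p now s
        { s with status := Function.update s.status c.epoch (some .notCommitted) } []
  /-- `CommitBlock(b)`: a decided block has arrived; commit it and all its ancestors -/
  | commitBlock (e : ℕ) (b : Block P H) (bc : Option (BlockCert n H))
      (hprop : .propose e b bc ∈ s.log) (hdec : s.decision e = some (S.hash b))
      (hnew : b ∉ s.ledger) :
      MsgStep S p now s { s with ledger := s.ledger ∪ {a | Ancestor S.hash a b} } []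

/-- The effect of the expiry of a timer (which has already been removed from `s`). -/
inductive TimerStep (S : System n P H) (p : Fin n) (now : ℝ) (s : Local n P H) :
    Timer H → Local n P H → List (Msg n P H) → Prop
  /-- the leader proposes, if it is still in the epoch -/
  | propose (e : ℕ) (he : s.epoch = e) (pl : P) :
      TimerStep S p now s (.epochChange e) { s with hasVoted := True } (S.proposal p s pl)
  | proposeStale (e : ℕ) (he : s.epoch ≠ e) : TimerStep S p now s (.epochChange e) s []
  | silence (e : ℕ) (he : s.epoch = e ∧ s.status e = some .active) :
      TimerStep S p now s (.certificate e) s [.signed p (.silence e)]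
  | silenceStale (e : ℕ) (he : ¬ (s.epoch = e ∧ s.status e = some .active)) :
      TimerStep S p now s (.certificate e) s []
  /-- regular commit rule -/
  | commit (e : ℕ) (h : H) (hact : s.status e = some .active) :
      TimerStep S p now s (.commit e (some h))
        { s with
          status := Function.update s.status e (some .committed)
          decision := Function.update s.decision e (some h) } []
  | commitNot (e : ℕ) (h : H) (hact : s.status e ≠ some .active) :
      TimerStep S p now s (.commit e (some h)) s []
  | nextEpoch (e : ℕ) (he : s.epoch = e) (s' : Local n P H) (out : List (Msg n P H))
      (hstart : S.StartEpoch p now (e + 1) s s' out) :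
      TimerStep S p now s (.commit e none) s' out
  | nextEpochStale (e : ℕ) (he : s.epoch ≠ e) : TimerStep S p now s (.commit e none) s []

/-- No rule triggered by received messages applies. -/
def Quiet (S : System n P H) (p : Fin n) (now : ℝ) (s : Local n P H) : Prop :=
  ∀ s' out, ¬ S.MsgStep p now s s' out

end System

/-- A global configuration: the current time, the local states (only those of honest replicas
matter), and the broadcasts `(sender, message, time)` made by honest replicas so far. -/
structure Config (n : ℕ) (P H : Type*) where
  now : ℝ
  loc : Fin n → Local n P H
  sent : Set (Fin n × Msg n P H × ℝ)

namespace System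

variable {n : ℕ} {P H : Type*}

def initial (n : ℕ) (P H : Type*) : Config n P H where
  now := 0
  loc := fun _ => Local.initial n P H
  sent := ∅

/-- Signatures of honest replicas cannot be forged: every signature of an honest replica in `m`
belongs to a message that this replica has broadcast before. Faulty replicas can produce any such
message `m`, and every message broadcast by an honest replica is of this kind. -/
def Genuine (S : System n P H) (C : Config n P H) (m : Msg n P H) : Prop :=
  ∀ x ∈ m.sigs, S.Honest x.1 → ∃ t, (x.1, .signed x.1 x.2, t) ∈ C.sent

/-- Replica `p` moves to state `s` and broadcasts `out`. -/
def update (C : Config n P H) (p : Fin n) (s : Local n P H) (out : List (Msg n P H)) :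
    Config n P H :=
  { C with
    loc := Function.update C.loc p s
    sent := C.sent ∪ {x | x.1 = p ∧ x.2.1 ∈ out ∧ x.2.2 = C.now} }

/-- The steps of the system in the hybrid synchronous model. -/
inductive Step (S : System n P H) (C : Config n P H) : Config n P H → Prop
  /-- an honest replica begins the execution with epoch 0 -/
  | boot (p : Fin n) (hp : S.Honest p) (hb : ¬ (C.loc p).booted) (ht : C.now = S.start p)
      (s' : Local n P H) (out : List (Msg n P H))
      (hs : S.StartEpoch p C.now 0 { C.loc p with booted := True } s' out) :
      Step S C (update C p s' out)
  /-- an honest replica receives a message, from an honest or a faulty replica -/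
  | receive (p : Fin n) (hp : S.Honest p) (m : Msg n P H) (hm : S.Genuine C m) :
      Step S C (update C p { C.loc p with log := insert m (C.loc p).log } [])
  /-- an honest replica executes a rule triggered by received messages -/
  | act (p : Fin n) (hp : S.Honest p) (hb : (C.loc p).booted)
      (s' : Local n P H) (out : List (Msg n P H)) (hs : S.MsgStep p C.now (C.loc p) s' out) :
      Step S C (update C p s' out)
  /-- a timer of an honest replica expires; messages that are due by this instant have been
  received, and have been processed, before -/
  | expire (p : Fin n) (hp : S.Honest p) (τ : Timer H) (hτ : (τ, C.now) ∈ (C.loc p).timers)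
      (hdue : ∀ q m t, (q, m, t) ∈ C.sent → S.deadline m t ≤ C.now → m ∈ (C.loc p).log)
      (hquiet : S.Quiet p C.now (C.loc p))
      (s' : Local n P H) (out : List (Msg n P H))
      (hs : S.TimerStep p C.now
        { C.loc p with timers := (C.loc p).timers \ {(τ, C.now)} } τ s' out) :
      Step S C (update C p s' out)
  /-- time passes; honest replicas act without delay, begin on time, serve their timers on time,
  and messages between honest replicas respect their deadlines -/
  | tick (t' : ℝ) (ht : C.now < t')
      (hstart : ∀ p, S.Honest p → ¬ (C.loc p).booted → t' ≤ S.start p)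
      (hquiet : ∀ p, S.Honest p → (C.loc p).booted → S.Quiet p C.now (C.loc p))
      (htimer : ∀ p, S.Honest p → ∀ τ d, (τ, d) ∈ (C.loc p).timers → t' ≤ d)
      (hdeliver : ∀ p, S.Honest p → ∀ q m t, (q, m, t) ∈ C.sent →
        m ∈ (C.loc p).log ∨ t' ≤ S.deadline m t) :
      Step S C { C with now := t' }

/-- The configurations that occur in executions of the system. -/
def Reachable (S : System n P H) : Config n P H → Prop :=
  Relation.ReflTransGen S.Step (initial n P H)

/-- Replica `p` has committed `b`: it has handed over `b` by `CommitBlock`, or it has decided, by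
one of the commit rules, the hash of `b` or of a block that extends `b` (the decided block itself
may still be missing). -/
def HasCommitted (S : System n P H) (C : Config n P H) (p : Fin n) (b : Block P H) : Prop :=
  b ∈ (C.loc p).ledger ∨
    ∃ e d, (C.loc p).decision e = some (S.hash d) ∧ Ancestor S.hash b d

end System

end AlterBFT

/-!
Epochs are synchronized: the certificates that entitle an honest replica to leave an epoch are
broadcast as small messages, so all honest replicas reach each epoch within `ΔS` of the first one.
This survives silence and equivocation certificates because every replica that gives up an epoch
waits for the same time `2ΔS`, and survives the fast commit rule because a replica that has all
votes of its current epoch also has a block certificate of it and moves on at once.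

Let `h` be decided in epoch `e`. Then every honest vote of epoch `e` is for `h`: under the fast rule
since honest replicas vote once per epoch, under the regular rule since honest votes end within
`ΔS` of the first block certificate and are broadcast together with the leader's vote, so that an
equivocation of the leader would be noticed during the `2ΔS` before the decision. Moreover no honest
replica leaves `e` without a lock of epoch at least `e`: whoever gives up `e` does so late enough to
receive a block certificate of `e`, or all the votes, before its own `2ΔS` are over; otherwise the
deciding replica would have learned of the misbehavior before deciding.

By induction over the execution, every honest vote in an epoch `≥ e` is therefore for a block that
extends the one with hash `h`. Since a decided hash has been voted for by an honest replica, the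
decided blocks lie on one chain, and blocks of equal height on a chain are equal.
-/

namespace AlterBFT

section BlockTree

variable {P H : Type*} {hash : Block P H → H} {a b d : Block P H} {j k : ℕ}

theorem Parent.leftUnique (hhash : Function.Injective hash) : Relator.LeftUnique (Parent hash) :=
  fun _ _ _ h h' => hhash (Option.some.inj (h.symm.trans h'))

theorem Ancestor.total (hhash : Function.Injective hash) (ha : Ancestor hash a d)
    (hb : Ancestor hash b d) : Ancestor hash a b ∨ Ancestor hash b a := by
  have := Relation.ReflTransGen.total_of_right_unique (Parent.leftUnique hhash).flip
    (Relation.reflTransGen_swap.mpr ha) (Relation.reflTransGen_swap.mpr hb)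
  exact this.symm.imp Relation.reflTransGen_swap.mp Relation.reflTransGen_swap.mp

theorem HasHeight.unique (hhash : Function.Injective hash) (hj : HasHeight hash b j)
    (hk : HasHeight hash b k) : j = k := by
  induction hj generalizing k with
  | first b hb =>
    cases hk with
    | first => rfl
    | next a _ _ hab => simp [Parent, hb] at hab
  | next a b j hab _ ih =>
    cases hk with
    | first _ hb => simp [Parent, hb] at hab
    | next a' _ _ ha'b ha' =>
      obtain rfl := Parent.leftUnique hhash hab ha'b
      rw [ih ha']

theorem HasHeight.exists_lt_of_transGen (hab : Relation.TransGen (Parent hash) a b)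
    (ha : HasHeight hash a j) : ∃ k, j < k ∧ HasHeight hash b k := by
  induction hab with
  | single h => exact ⟨j + 1, j.lt_succ_self, .next _ _ _ h ha⟩
  | tail _ h ih =>
    obtain ⟨k, hjk, hk⟩ := ih
    exact ⟨k + 1, hjk.trans k.lt_succ_self, .next _ _ _ h hk⟩

theorem Ancestor.eq_of_hasHeight (hhash : Function.Injective hash) (hab : Ancestor hash a b)
    (ha : HasHeight hash a k) (hb : HasHeight hash b k) : a = b := by
  rcases Relation.reflTransGen_iff_eq_or_transGen.mp hab with rfl | h
  · rfl
  · obtain ⟨j, hkj, hj⟩ := ha.exists_lt_of_transGen h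
    exact absurd (hb.unique hhash hj) hkj.ne

theorem eq_of_ancestor_of_hasHeight (hhash : Function.Injective hash) (had : Ancestor hash a d)
    (hbd : Ancestor hash b d) (ha : HasHeight hash a k) (hb : HasHeight hash b k) : a = b := by
  rcases had.total hhash hbd with h | h
  · exact h.eq_of_hasHeight hhash ha hb
  · exact (h.eq_of_hasHeight hhash hb ha).symm

end BlockTree

namespace System

variable {n : ℕ} {P H : Type*} {S : System n P H} {C C' : Config n P H} {p q : Fin n}
  {s s' : Local n P H} {out : List (Msg n P H)}

section Steps

/-- All messages due at `p` have arrived, and `p` has nothing left to process. -/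
structure Settled (S : System n P H) (C : Config n P H) (p : Fin n) : Prop where
  mem_log : ∀ {q m t}, (q, m, t) ∈ C.sent → S.deadline m t ≤ C.now → m ∈ (C.loc p).log
  quiet : S.Quiet p C.now (C.loc p)

/-- The steps in which a single replica acts: `Act S C p s' out` says that in the configuration `C`
replica `p` may move to state `s'` and broadcast `out`. -/
inductive Act (S : System n P H) (C : Config n P H) (p : Fin n) :
    Local n P H → List (Msg n P H) → Prop
  | boot (hb : ¬ (C.loc p).booted) (ht : C.now = S.start p)
      (s' : Local n P H) (out : List (Msg n P H))
      (hs : S.StartEpoch p C.now 0 { C.loc p with booted := True } s' out) : Act S C p s' out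
  | receive (m : Msg n P H) (hm : S.Genuine C m) :
      Act S C p { C.loc p with log := insert m (C.loc p).log } []
  | rule (hb : (C.loc p).booted) (s' : Local n P H) (out : List (Msg n P H))
      (hs : S.MsgStep p C.now (C.loc p) s' out) : Act S C p s' out
  | expire (τ : Timer H) (hτ : (τ, C.now) ∈ (C.loc p).timers) (hset : Settled S C p)
      (s' : Local n P H) (out : List (Msg n P H))
      (hs : S.TimerStep p C.now
        { C.loc p with timers := (C.loc p).timers \ {(τ, C.now)} } τ s' out) : Act S C p s' out

/-- The steps in which time passes until `t'`. -/
structure Tick (S : System n P H) (C : Config n P H) (t' : ℝ) : Prop where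
  lt : C.now < t'
  start : ∀ {p}, S.Honest p → ¬ (C.loc p).booted → t' ≤ S.start p
  settled : ∀ {p}, S.Honest p → (C.loc p).booted → Settled S C p
  timer : ∀ {p}, S.Honest p → ∀ {τ d}, (τ, d) ∈ (C.loc p).timers → t' ≤ d
  deliver : ∀ {p}, S.Honest p → ∀ {q m t}, (q, m, t) ∈ C.sent →
    m ∈ (C.loc p).log ∨ t' ≤ S.deadline m t

theorem step_iff : S.Step C C' ↔
    (∃ p s' out, S.Honest p ∧ Act S C p s' out ∧ C' = update C p s' out) ∨
      ∃ t', Tick S C t' ∧ C' = { C with now := t' } := by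
  constructor
  · intro h
    cases h with
    | boot p hp hb ht s' out hs => exact .inl ⟨p, s', out, hp, .boot hb ht s' out hs, rfl⟩
    | receive p hp m hm => exact .inl ⟨p, _, _, hp, .receive m hm, rfl⟩
    | act p hp hb s' out hs => exact .inl ⟨p, s', out, hp, .rule hb s' out hs, rfl⟩
    | expire p hp τ hτ hdue hquiet s' out hs =>
      exact .inl ⟨p, s', out, hp, .expire τ hτ ⟨hdue _ _ _, hquiet⟩ s' out hs, rfl⟩
    | tick t' ht hstart hquiet htimer hdeliver =>
      refine .inr ⟨t', ⟨ht, hstart _, fun hp hb => ⟨fun hm hd => ?_, hquiet _ hp hb⟩,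
        fun hp => htimer _ hp _ _, fun hp => hdeliver _ hp _ _ _⟩, rfl⟩
      exact (hdeliver _ hp _ _ _ hm).resolve_right (hd.trans_lt ht).not_ge
  · rintro (⟨p, s', out, hp, ha, rfl⟩ | ⟨t', ht, rfl⟩)
    · cases ha with
      | boot hb ht _ _ hs => exact .boot p hp hb ht _ _ hs
      | receive m hm => exact .receive p hp m hm
      | rule hb _ _ hs => exact .act p hp hb _ _ hs
      | expire τ hτ hset _ _ hs => exact .expire p hp τ hτ (fun _ _ _ => hset.1) hset.2 _ _ hs
    · exact .tick t' ht.lt (fun _ => ht.start) (fun _ hp hb => (ht.settled hp hb).2)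
        (fun _ hp _ _ => ht.timer hp) fun _ hp _ _ _ => ht.deliver hp

theorem Reachable.act (hC : S.Reachable C) (hp : S.Honest p) (h : Act S C p s' out) :
    S.Reachable (update C p s' out) :=
  hC.tail (step_iff.mpr (.inl ⟨p, s', out, hp, h, rfl⟩))

theorem Reachable.tick {t' : ℝ} (hC : S.Reachable C) (h : Tick S C t') :
    S.Reachable { C with now := t' } :=
  hC.tail (step_iff.mpr (.inr ⟨t', h, rfl⟩))

@[elab_as_elim]
theorem Reachable.induction {motive : ∀ C, S.Reachable C → Prop}
    (init : motive (initial n P H) .refl)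
    (act : ∀ C p s' out (hC : S.Reachable C) (hp : S.Honest p) (ha : Act S C p s' out),
      motive C hC → motive (update C p s' out) (hC.act hp ha))
    (tick : ∀ C t' (hC : S.Reachable C) (ht : Tick S C t'),
      motive C hC → motive { C with now := t' } (hC.tick ht))
    {C : Config n P H} (hC : S.Reachable C) : motive C hC := by
  induction hC with
  | refl => exact init
  | tail hC hs ih =>
    rcases step_iff.mp hs with ⟨p, s', out, hp, ha, rfl⟩ | ⟨t', ht, rfl⟩
    · exact act _ p s' out hC hp ha ih
    · exact tick _ t' hC ht ih

theorem update_loc : (update C p s out).loc q = if q = p then s else C.loc q := by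
  simp [update, Function.update_apply]

theorem mem_update_sent {m : Msg n P H} {t : ℝ} :
    (q, m, t) ∈ (update C p s out).sent ↔ (q, m, t) ∈ C.sent ∨ q = p ∧ m ∈ out ∧ t = C.now := by
  simp [update]

@[elab_as_elim]
theorem Reachable.loc_induction {motive : Local n P H → Prop} {C : Config n P H}
    (hC : S.Reachable C) (q : Fin n) (init : motive (Local.initial n P H))
    (act : ∀ C s' out, S.Reachable C → Act S C q s' out → motive (C.loc q) → motive s') :
    motive (C.loc q) := by
  induction hC using Reachable.induction with
  | init => exact init
  | act C p s' out hC _ ha ih =>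
    rw [update_loc]
    split_ifs with h
    · subst h
      exact act C s' out hC ha ih
    · exact ih
  | tick _ _ _ _ ih => exact ih

end Steps

section StartEpoch

variable {now : ℝ} {e : ℕ}

@[grind →]
theorem StartEpoch.epoch_eq (h : S.StartEpoch p now e s s' out) : s'.epoch = e := by
  cases h <;> rfl

@[grind →]
theorem StartEpoch.booted_eq (h : S.StartEpoch p now e s s' out) : s'.booted = s.booted := by
  cases h <;> rfl

@[grind →]
theorem StartEpoch.locked_eq (h : S.StartEpoch p now e s s' out) : s'.locked = s.locked := by
  cases h <;> rfl

@[grind =>]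
theorem StartEpoch.status_eq (h : S.StartEpoch p now e s s' out) (e' : ℕ) :
    s'.status e' = if e' = e then some .active else s.status e' := by
  cases h <;> simp [enter, Function.update_apply]

@[grind =>]
theorem StartEpoch.decision_eq (h : S.StartEpoch p now e s s' out) (e' : ℕ) :
    s'.decision e' = if e' = e then none else s.decision e' := by
  cases h <;> simp [enter, Function.update_apply]

@[grind →]
theorem StartEpoch.log_eq (h : S.StartEpoch p now e s s' out) : s'.log = s.log := by
  cases h <;> rfl

@[grind →]
theorem StartEpoch.ledger_eq (h : S.StartEpoch p now e s s' out) : s'.ledger = s.ledger := by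
  cases h <;> rfl

@[grind →]
theorem StartEpoch.mem_timers {τ : Timer H} {d : ℝ}
    (h : S.StartEpoch p now e s s' out) (hτ : (τ, d) ∈ s'.timers) :
    (τ, d) ∈ s.timers ∨ τ = .certificate e ∨
      τ = .epochChange e ∧ d = now + 2 * S.ΔS ∧ S.leader e = p ∧ ¬ s'.hasVoted ∧ out = [] := by
  cases h <;> simp_all [enter] <;> tauto

@[grind →]
theorem StartEpoch.mem_out (h : S.StartEpoch p now e s s' out) {m : Msg n P H} (hm : m ∈ out) :
    s'.hasVoted ∧ S.leader e = p ∧ ∃ pl, out = S.proposal p (S.enter now e s) pl := by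
  cases h <;> simp_all

theorem StartEpoch.exists [Nonempty P] (S : System n P H) (p : Fin n) (now : ℝ) (e : ℕ)
    (s : Local n P H) : ∃ s' out, S.StartEpoch p now e s s' out := by
  obtain ⟨pl⟩ := ‹Nonempty P›
  by_cases hp : S.leader e = p
  · by_cases hs : ProposesAtOnce s e
    · exact ⟨_, _, .propose hp hs pl⟩
    · exact ⟨_, _, .wait hp hs⟩
  · exact ⟨_, _, .follower hp⟩

end StartEpoch

/-- The log contains the votes of all replicas for `h` in epoch `e`. -/
def AllVotes (log : Set (Msg n P H)) (e : ℕ) (h : H) : Prop :=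
  ∀ r, .signed r (.vote e h) ∈ log

section LocalInvariants

theorem Act.booted (ha : Act S C q s' out) (hb : (C.loc q).booted) : s'.booted := by
  cases ha with
  | boot => contradiction
  | receive => exact hb
  | rule _ _ _ hs => cases hs <;> grind
  | expire _ _ _ _ _ hs => cases hs <;> grind

theorem Reachable.eq_initial_of_not_booted (hC : S.Reachable C) (hb : ¬ (C.loc q).booted) :
    C.loc q = { Local.initial n P H with log := (C.loc q).log } := by
  revert hb
  refine hC.loc_induction q (by simp [Local.initial]) fun C s' out _ ha ih hb => ?_
  have ih := ih fun h => hb (ha.booted h)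
  cases ha with
  | boot _ _ _ _ hs => exact absurd (hs.booted_eq ▸ trivial) hb
  | receive m hm => rw [ih]
  | rule hb' _ _ hs => exact absurd ((Act.rule hb' _ _ hs).booted hb') hb
  | expire τ hτ => rw [ih] at hτ; exact hτ.elim

theorem Reachable.booted_of_mem_timers (hC : S.Reachable C) {x : Timer H × ℝ}
    (hx : x ∈ (C.loc q).timers) : (C.loc q).booted := by
  by_contra hb
  rw [hC.eq_initial_of_not_booted hb] at hx
  exact hx

theorem Reachable.le_epoch_of_status_ne_none (hC : S.Reachable C) {e : ℕ}
    (he : (C.loc q).status e ≠ none) : e ≤ (C.loc q).epoch := by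
  revert he
  refine hC.loc_induction q (by simp [Local.initial]) fun C s' out hC ha ih he => ?_
  cases ha with
  | boot hb => grind [hC.eq_initial_of_not_booted hb, Local.initial]
  | receive => exact ih he
  | rule _ _ _ hs => cases hs <;> grind
  | expire _ _ _ _ _ hs => cases hs <;> grind

theorem Reachable.status_epoch_ne_none (hC : S.Reachable C) (hb : (C.loc q).booted) :
    (C.loc q).status (C.loc q).epoch ≠ none := by
  revert hb
  refine hC.loc_induction q (by simp [Local.initial]) fun C s' out hC ha ih hb => ?_
  cases ha with
  | boot => grind
  | receive => exact ih hb
  | rule _ _ _ hs => cases hs <;> grind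
  | expire _ hτ _ _ _ hs =>
    have := hC.booted_of_mem_timers hτ
    cases hs <;> grind

theorem Reachable.lt_epoch_of_commit_timer (hC : S.Reachable C) {e : ℕ} {h : H} {d : ℝ}
    (hτ : (.commit e (some h), d) ∈ (C.loc q).timers) : e < (C.loc q).epoch := by
  revert hτ
  refine hC.loc_induction q (by simp [Local.initial]) fun C s' out hC ha ih hτ => ?_
  cases ha with
  | boot hb => grind [hC.eq_initial_of_not_booted hb, Local.initial]
  | receive => exact ih hτ
  | rule _ _ _ hs => cases hs <;> grind
  | expire _ _ _ _ _ hs => cases hs <;> grind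

theorem Reachable.le_epoch_of_epochChange_timer (hC : S.Reachable C) {e : ℕ} {d : ℝ}
    (hτ : (.epochChange e, d) ∈ (C.loc q).timers) : e ≤ (C.loc q).epoch := by
  revert hτ
  refine hC.loc_induction q (by simp [Local.initial]) fun C s' out hC ha ih hτ => ?_
  cases ha with
  | boot hb => grind [hC.eq_initial_of_not_booted hb, Local.initial]
  | receive => exact ih hτ
  | rule _ _ _ hs => cases hs <;> grind
  | expire _ _ _ _ _ hs => cases hs <;> grind

theorem Reachable.leader_eq_of_epochChange_timer (hC : S.Reachable C) {e : ℕ} {d : ℝ}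
    (hτ : (.epochChange e, d) ∈ (C.loc q).timers) : S.leader e = q := by
  revert hτ
  refine hC.loc_induction q (by simp [Local.initial]) fun C s' out _ ha ih hτ => ?_
  cases ha with
  | boot => grind
  | receive => exact ih hτ
  | rule _ _ _ hs => cases hs <;> grind
  | expire _ _ _ _ _ hs => cases hs <;> grind

theorem Reachable.epochChange_timer_unique (hC : S.Reachable C) {e : ℕ} {d d' : ℝ}
    (hd : (.epochChange e, d) ∈ (C.loc q).timers) (hd' : (.epochChange e, d') ∈ (C.loc q).timers) :
    d = d' := by
  revert hd hd'
  refine hC.loc_induction q (by simp [Local.initial]) fun C s' out hC ha ih hd hd' => ?_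
  have := fun e d => hC.le_epoch_of_epochChange_timer (q := q) (e := e) (d := d)
  cases ha with
  | boot hb => grind [hC.eq_initial_of_not_booted hb, Local.initial]
  | receive => exact ih hd hd'
  | rule _ _ _ hs => cases hs <;> grind
  | expire _ _ _ _ _ hs => cases hs <;> grind

theorem Reachable.exists_allVotes_of_committed (hC : S.Reachable C)
    (he : (C.loc q).status (C.loc q).epoch = some .committed) :
    ∃ h, AllVotes (C.loc q).log (C.loc q).epoch h := by
  revert he
  refine hC.loc_induction q (by simp [Local.initial]) fun C s' out hC ha ih he => ?_
  have := fun e h d => hC.lt_epoch_of_commit_timer (q := q) (e := e) (h := h) (d := d)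
  cases ha with
  | boot => grind
  | receive =>
    obtain ⟨h, hall⟩ := ih he
    exact ⟨h, fun r => .inr (hall r)⟩
  | rule _ _ _ hs =>
    cases hs with
    | fastCommit _ e h hall =>
      have hall : AllVotes (C.loc q).log e h := hall
      grind
    | _ => grind
  | expire _ _ _ _ _ hs => cases hs <;> grind

theorem Reachable.exists_commit_timer_of_notCommitted (hC : S.Reachable C)
    (he : (C.loc q).status (C.loc q).epoch = some .notCommitted) :
    ∃ d, (.commit (C.loc q).epoch none, d) ∈ (C.loc q).timers := by
  revert he
  refine hC.loc_induction q (by simp [Local.initial]) fun C s' out _ ha ih he => ?_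
  cases ha with
  | boot => grind
  | receive => exact ih he
  | rule _ _ _ hs => cases hs <;> grind
  | expire _ _ _ _ _ hs => cases hs <;> grind

theorem Reachable.committed_of_decision (hC : S.Reachable C) {e : ℕ} {h : H}
    (hd : (C.loc q).decision e = some h) : (C.loc q).status e = some .committed := by
  revert hd
  refine hC.loc_induction q (by simp [Local.initial]) fun C s' out _ ha ih hd => ?_
  cases ha with
  | boot => grind
  | receive => exact ih hd
  | rule _ _ _ hs => cases hs <;> grind
  | expire _ _ _ _ _ hs => cases hs <;> grind

/-- `enter` resets only the decision of an epoch that was never started. -/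
theorem Act.decision (hC : S.Reachable C) (ha : Act S C q s' out) {e : ℕ} {h : H}
    (hd : (C.loc q).decision e = some h) : s'.decision e = some h := by
  have hst := hC.committed_of_decision hd
  have := hC.le_epoch_of_status_ne_none (q := q) (e := e) (by simp [hst])
  cases ha with
  | boot hb => grind [hC.eq_initial_of_not_booted hb, Local.initial]
  | receive => exact hd
  | rule _ _ _ hs => cases hs <;> grind
  | expire _ _ _ _ _ hs => cases hs <;> grind

theorem Act.mem_ledger (ha : Act S C q s' out) {b : Block P H} (hb : b ∈ s'.ledger) :
    b ∈ (C.loc q).ledger ∨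
      ∃ e d, s'.decision e = some (S.hash d) ∧ Ancestor S.hash b d := by
  cases ha with
  | boot => grind
  | receive => exact .inl hb
  | rule _ _ _ hs => cases hs <;> grind
  | expire _ _ _ _ _ hs => cases hs <;> grind

theorem Reachable.exists_decision_of_mem_ledger (hC : S.Reachable C) {b : Block P H}
    (hb : b ∈ (C.loc q).ledger) :
    ∃ e d, (C.loc q).decision e = some (S.hash d) ∧ Ancestor S.hash b d := by
  revert hb
  refine hC.loc_induction q (by simp [Local.initial]) fun C s' out hC ha ih hb => ?_
  rcases ha.mem_ledger hb with hb | hb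
  · obtain ⟨e, d, hd, hbd⟩ := ih hb
    exact ⟨e, d, ha.decision hC hd, hbd⟩
  · exact hb

end LocalInvariants

section Acts

variable {e : ℕ} {h : H} {d : ℝ}

theorem Act.epoch_le (hC : S.Reachable C) (ha : Act S C q s' out) :
    (C.loc q).epoch ≤ s'.epoch := by
  cases ha with
  | boot hb => grind [hC.eq_initial_of_not_booted hb, Local.initial]
  | receive => exact le_rfl
  | rule _ _ _ hs => cases hs <;> grind
  | expire _ _ _ _ _ hs => cases hs <;> grind

theorem Act.hasVoted (hC : S.Reachable C) (ha : Act S C q s' out) (hv : (C.loc q).hasVoted)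
    (he : s'.epoch = (C.loc q).epoch) : s'.hasVoted := by
  cases ha with
  | boot hb => grind [hC.eq_initial_of_not_booted hb, Local.initial]
  | receive => exact hv
  | rule _ _ _ hs => cases hs <;> grind
  | expire _ _ _ _ _ hs => cases hs <;> grind

theorem Act.status_ne_active (ha : Act S C q s' out) (hb : (C.loc q).booted)
    (he : e ≤ (C.loc q).epoch) (hst : (C.loc q).status e ≠ some .active) :
    s'.status e ≠ some .active := by
  cases ha with
  | boot => contradiction
  | receive => exact hst
  | rule _ _ _ hs => cases hs <;> grind
  | expire _ _ _ _ _ hs => cases hs <;> grind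

theorem Act.mem_log (ha : Act S C q s' out) {m : Msg n P H} (hm : m ∈ s'.log) :
    m ∈ (C.loc q).log ∨ S.Genuine C m := by
  cases ha with
  | boot => grind
  | receive => grind
  | rule _ _ _ hs => cases hs <;> grind
  | expire _ _ _ _ _ hs => cases hs <;> grind

theorem Act.of_vote_mem (hC : S.Reachable C) (ha : Act S C q s' out)
    (hm : .signed q (.vote e h) ∈ out) : s'.booted ∧ s'.epoch = e ∧ s'.hasVoted := by
  cases ha with
  | boot => grind [proposal, enter]
  | receive => grind
  | rule _ _ _ hs => cases hs <;> grind [proposal, enter]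
  | expire _ hτ _ _ _ hs =>
    have := hC.booted_of_mem_timers hτ
    cases hs <;> grind [proposal, enter]

theorem Act.leader_vote_mem (hC : S.Reachable C) (ha : Act S C q s' out)
    (hm : .signed q (.vote e h) ∈ out) : .signed (S.leader e) (.vote e h) ∈ out := by
  cases ha with
  | boot => grind [proposal, enter]
  | receive => grind
  | rule _ _ _ hs => cases hs <;> grind [proposal, enter]
  | expire _ hτ _ _ _ hs =>
    have := fun e d => hC.leader_eq_of_epochChange_timer (q := q) (e := e) (d := d)
    cases hs <;> grind [proposal, enter]

theorem Act.vote_unique {h' : H} (ha : Act S C q s' out)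
    (hm : .signed q (.vote e h) ∈ out) (hm' : .signed q (.vote e h') ∈ out) : h = h' := by
  cases ha with
  | boot => grind [proposal, enter]
  | receive => grind
  | rule _ _ _ hs => cases hs <;> grind [proposal, enter]
  | expire _ _ _ _ _ hs => cases hs <;> grind [proposal, enter]

theorem Act.exists_block_of_vote_mem (ha : Act S C q s' out)
    (hm : .signed q (.vote e h) ∈ out) :
    ∃ b, h = S.hash b ∧ (b.prev = s'.locked.map BlockCert.id ∨
      ∃ bc, .propose e b bc ∈ (C.loc q).log ∧ (C.loc q).epoch = e ∧ S.Accepts (C.loc q) b bc) := by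
  cases ha with
  | boot => grind [proposal, enter, newBlock]
  | receive => grind
  | rule _ _ _ hs => cases hs <;> grind [proposal, enter, newBlock]
  | expire _ _ _ _ _ hs => cases hs <;> grind [proposal, enter, newBlock]

theorem Act.hasBlockCert_of_quit_mem (ha : Act S C q s' out) {c : BlockCert n H}
    (hm : .quit (.block c) ∈ out) : S.HasBlockCert (C.loc q).log c := by
  cases ha with
  | boot => grind [proposal]
  | receive => grind
  | rule _ _ _ hs => cases hs <;> grind [proposal, HasMisbehavior, ValidMisbehavior]
  | expire _ _ _ _ _ hs => cases hs <;> grind [proposal]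

theorem Act.of_quit_mem (ha : Act S C q s' out) {c : Cert n H} (hc : S.ValidMisbehavior c)
    (hm : .quit c ∈ out) : (C.loc q).booted ∧ (C.loc q).epoch = c.epoch ∧
      (C.loc q).status c.epoch = some .active := by
  cases ha with
  | boot => grind [proposal]
  | receive => grind
  | rule _ _ _ hs => cases hs <;> grind [proposal, ValidMisbehavior]
  | expire _ _ _ _ _ hs => cases hs <;> grind [proposal]

theorem Act.commit_none_timer (ha : Act S C q s' out) (hd : (.commit e none, d) ∈ s'.timers) :
    (.commit e none, d) ∈ (C.loc q).timers ∨ d = C.now + 2 * S.ΔS ∧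
      ∃ c, S.ValidMisbehavior c ∧ c.epoch = e ∧ .quit c ∈ out := by
  cases ha with
  | boot => grind
  | receive => exact .inl hd
  | rule _ _ _ hs => cases hs <;> grind [HasMisbehavior]
  | expire _ _ _ _ _ hs => cases hs <;> grind

theorem Act.commit_some_timer (ha : Act S C q s' out)
    (hd : (.commit e (some h), d) ∈ s'.timers) :
    (.commit e (some h), d) ∈ (C.loc q).timers ∨ d = C.now + 2 * S.ΔS ∧
      ∃ c, c.epoch = e ∧ c.id = h ∧ .quit (.block c) ∈ out := by
  cases ha with
  | boot => grind
  | receive => exact .inl hd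
  | rule _ _ _ hs => cases hs <;> grind
  | expire _ _ _ _ _ hs => cases hs <;> grind

/-- How a step may change the epoch and the lock of a replica. -/
inductive EpochChange (S : System n P H) (C : Config n P H) (p : Fin n) (s' : Local n P H)
    (out : List (Msg n P H)) : Prop
  | same (hb : (C.loc p).booted ↔ s'.booted) (he : s'.epoch = (C.loc p).epoch)
      (hl : s'.locked = (C.loc p).locked ∨ ∃ c, s'.locked = some c ∧ .quit (.block c) ∈ out ∧
        ∀ l, (C.loc p).locked = some l → l.epoch < c.epoch)
  | boot (ht : C.now = S.start p) (he : s'.epoch = 0) (hl : s'.locked = (C.loc p).locked)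
  | blockCert (c : BlockCert n H) (hc : .quit (.block c) ∈ out) (hce : c.epoch = (C.loc p).epoch)
      (he : s'.epoch = (C.loc p).epoch + 1) (hl : s'.locked = some c)
  | misbehavior (hτ : (.commit (C.loc p).epoch none, C.now) ∈ (C.loc p).timers)
      (hset : Settled S C p) (he : s'.epoch = (C.loc p).epoch + 1)
      (hl : s'.locked = (C.loc p).locked)

theorem Act.epochChange (ha : Act S C q s' out) : EpochChange S C q s' out := by
  cases ha with
  | boot _ ht _ _ hs => exact .boot ht hs.epoch_eq hs.locked_eq
  | receive => exact .same .rfl rfl (.inl rfl)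
  | rule hb _ _ hs =>
    cases hs with
    | blockCertActive c _ he _ _ _ hs => exact .blockCert c (.head _) he hs.epoch_eq hs.locked_eq
    | blockCertInactive c _ he _ _ _ hs => exact .blockCert c (.head _) he hs.epoch_eq hs.locked_eq
    | blockCertLeader c _ _ _ hl => exact .same .rfl rfl (.inr ⟨c, rfl, .head _, hl⟩)
    | _ => exact .same .rfl rfl (.inl rfl)
  | expire τ hτ hset _ _ hs =>
    cases hs with
    | nextEpoch e he _ _ hs =>
      obtain rfl : (C.loc q).epoch = e := he
      exact .misbehavior hτ hset hs.epoch_eq hs.locked_eq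
    | _ => exact .same .rfl rfl (.inl rfl)

theorem Act.locked (ha : Act S C q s' out) {l : BlockCert n H} (hl : s'.locked = some l) :
    (C.loc q).locked = some l ∨ S.HasBlockCert (C.loc q).log l := by
  have := fun hm => ha.hasBlockCert_of_quit_mem (c := l) hm
  cases ha.epochChange <;> grind

/-- Replica `p` can decide `h` in epoch `e`, by the fast or by the regular commit rule. -/
structure Decides (S : System n P H) (C : Config n P H) (p : Fin n) (e : ℕ) (h : H) : Prop where
  active : (C.loc p).status e = some .active
  allVotes_or_expired : AllVotes (C.loc p).log e h ∨
    (.commit e (some h), C.now) ∈ (C.loc p).timers ∧ Settled S C p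

theorem Act.decides_of_decision (ha : Act S C q s' out) (hd : s'.decision e = some h) :
    (C.loc q).decision e = some h ∨ Decides S C q e h := by
  cases ha with
  | boot => grind
  | receive => exact .inl hd
  | rule _ _ _ hs =>
    cases hs with
    | fastCommit _ e' h' hall hact =>
      have : Decides S C q e' h' := ⟨hact, .inl hall⟩
      grind
    | _ => grind
  | expire τ hτ hset _ _ hs =>
    cases hs with
    | commit e' h' hact =>
      have : Decides S C q e' h' := ⟨hact, .inr ⟨hτ, hset⟩⟩
      grind
    | _ => grind

end Acts

section History

/-- `C'` may occur after `C` in an execution: time and replicas have moved on, and what was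
broadcast in between carries a time stamp of at least `C.now`. -/
structure Later (C C' : Config n P H) : Prop where
  now_le : C.now ≤ C'.now
  mem_sent : ∀ {q m t}, (q, m, t) ∈ C.sent → (q, m, t) ∈ C'.sent
  mem_sent_or_now_le : ∀ {q m t}, (q, m, t) ∈ C'.sent → (q, m, t) ∈ C.sent ∨ C.now ≤ t
  booted : ∀ {q}, (C.loc q).booted → (C'.loc q).booted
  epoch_le : ∀ q, (C.loc q).epoch ≤ (C'.loc q).epoch
  hasVoted : ∀ {q}, (C.loc q).hasVoted → (C'.loc q).epoch = (C.loc q).epoch → (C'.loc q).hasVoted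
  status_ne_active : ∀ {q e}, (C.loc q).booted → e ≤ (C.loc q).epoch →
    (C.loc q).status e ≠ some .active → (C'.loc q).status e ≠ some .active

theorem Later.refl (C : Config n P H) : Later C C where
  now_le := le_rfl
  mem_sent := id
  mem_sent_or_now_le := .inl
  booted := id
  epoch_le _ := le_rfl
  hasVoted h _ := h
  status_ne_active _ _ h := h

theorem Later.trans {C₁ C₂ C₃ : Config n P H} (h : Later C₁ C₂) (h' : Later C₂ C₃) :
    Later C₁ C₃ where
  now_le := h.now_le.trans h'.now_le
  mem_sent hm := h'.mem_sent (h.mem_sent hm)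
  mem_sent_or_now_le hm :=
    (h'.mem_sent_or_now_le hm).elim h.mem_sent_or_now_le fun ht => .inr (h.now_le.trans ht)
  booted hb := h'.booted (h.booted hb)
  epoch_le q := (h.epoch_le q).trans (h'.epoch_le q)
  hasVoted {q} hv he := by
    have := h.epoch_le q
    have := h'.epoch_le q
    exact h'.hasVoted (h.hasVoted hv (by omega)) (by omega)
  status_ne_active {q _} hb he hst := h'.status_ne_active (h.booted hb)
    (he.trans (h.epoch_le q)) (h.status_ne_active hb he hst)

theorem Act.later (hC : S.Reachable C) (ha : Act S C p s' out) : Later C (update C p s' out) where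
  now_le := le_rfl
  mem_sent hm := mem_update_sent.mpr (.inl hm)
  mem_sent_or_now_le hm := (mem_update_sent.mp hm).imp_right fun h => h.2.2.ge
  booted := by grind [update_loc, ha.booted]
  epoch_le := by grind [update_loc, ha.epoch_le hC]
  hasVoted := by grind [update_loc, ha.hasVoted hC]
  status_ne_active := by
    intro q e hb he hst
    rw [update_loc]
    split_ifs with hqp
    · subst hqp
      exact ha.status_ne_active hb he hst
    · exact hst

theorem Tick.later {t' : ℝ} (ht : Tick S C t') : Later C { C with now := t' } where
  now_le := ht.lt.le
  mem_sent := id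
  mem_sent_or_now_le := .inl
  booted := id
  epoch_le _ := le_rfl
  hasVoted h _ := h
  status_ne_active _ _ h := h

@[elab_as_elim]
theorem Reachable.history_induction {motive : Config n P H → Local n P H → Prop}
    (hC : S.Reachable C) (q : Fin n)
    (mono : ∀ {C C' s}, Later C C' → motive C s → motive C' s)
    (init : ∀ C, motive C (Local.initial n P H))
    (act : ∀ C s' out, S.Reachable C → S.Honest q → Act S C q s' out → motive C (C.loc q) →
      motive (update C q s' out) s') :
    motive C (C.loc q) := by
  induction hC using Reachable.induction with
  | init => exact init _
  | act C p s' out hC hp ha ih =>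
    rw [update_loc]
    split_ifs with h
    · subst h
      exact act C s' out hC hp ha ih
    · exact mono (ha.later hC) ih
  | tick _ _ _ ht ih => exact mono ht.later ih

theorem Reachable.now_nonneg (hC : S.Reachable C) : 0 ≤ C.now := by
  induction hC using Reachable.induction with
  | init => exact le_rfl
  | act _ _ _ _ _ _ _ ih => exact ih
  | tick _ _ _ ht ih => exact ih.trans ht.lt.le

theorem Reachable.exists_tick (hC : S.Reachable C) {T : ℝ} (h0 : 0 ≤ T) (hT : T < C.now) :
    ∃ C₀ t', S.Reachable C₀ ∧ Tick S C₀ t' ∧ T < t' ∧ Later { C₀ with now := t' } C := by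
  induction hC using Reachable.induction with
  | init => exact absurd h0 hT.not_ge
  | act C p s' out hC _ ha ih =>
    obtain ⟨C₀, t', h₀, ht, hlt, hl⟩ := ih hT
    exact ⟨C₀, t', h₀, ht, hlt, hl.trans (ha.later hC)⟩
  | tick C t' hC ht ih =>
    rcases lt_or_ge T C.now with h | _
    · obtain ⟨C₀, t₀, h₀, ht₀, hlt, hl⟩ := ih h
      exact ⟨C₀, t₀, h₀, ht₀, hlt, hl.trans ht.later⟩
    · exact ⟨C, t', hC, ht, hT, .refl _⟩

theorem Reachable.exists_act_of_mem_sent (hC : S.Reachable C) {m : Msg n P H} {t : ℝ}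
    (hm : (q, m, t) ∈ C.sent) :
    ∃ C₀ s' out, S.Reachable C₀ ∧ S.Honest q ∧ Act S C₀ q s' out ∧ m ∈ out ∧ C₀.now = t ∧
      Later (update C₀ q s' out) C := by
  induction hC using Reachable.induction with
  | init => exact hm.elim
  | act C p s' out hC hp ha ih =>
    rcases mem_update_sent.mp hm with hm' | ⟨rfl, hm', rfl⟩
    · obtain ⟨C₀, s₀, out₀, h₀, hq, ha₀, hm₀, ht, hl⟩ := ih hm'
      exact ⟨C₀, s₀, out₀, h₀, hq, ha₀, hm₀, ht, hl.trans (ha.later hC)⟩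
    · exact ⟨C, s', out, hC, hp, ha, hm', rfl, .refl _⟩
  | tick _ _ _ ht ih =>
    obtain ⟨C₀, s₀, out₀, h₀, hq, ha₀, hm₀, ht₀, hl⟩ := ih hm
    exact ⟨C₀, s₀, out₀, h₀, hq, ha₀, hm₀, ht₀, hl.trans ht.later⟩

variable {e : ℕ} {h : H} {t : ℝ} {c : BlockCert n H}

theorem Reachable.honest_of_mem_sent (hC : S.Reachable C) {m : Msg n P H}
    (hm : (q, m, t) ∈ C.sent) : S.Honest q := by
  obtain ⟨_, _, _, _, hq, -⟩ := hC.exists_act_of_mem_sent hm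
  exact hq

theorem Reachable.nonneg_of_mem_sent (hC : S.Reachable C) {m : Msg n P H}
    (hm : (q, m, t) ∈ C.sent) : 0 ≤ t := by
  obtain ⟨_, _, _, hC₀, _, _, _, rfl, _⟩ := hC.exists_act_of_mem_sent hm
  exact hC₀.now_nonneg

theorem Reachable.le_now_of_mem_sent (hC : S.Reachable C) {m : Msg n P H}
    (hm : (q, m, t) ∈ C.sent) : t ≤ C.now := by
  obtain ⟨_, _, _, _, _, _, _, rfl, hl⟩ := hC.exists_act_of_mem_sent hm
  exact hl.now_le

theorem Later.mem_sent_of_lt (hl : Later C C') {m : Msg n P H} (hm : (q, m, t) ∈ C'.sent)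
    (ht : t < C.now) : (q, m, t) ∈ C.sent :=
  (hl.mem_sent_or_now_le hm).resolve_right ht.not_ge

theorem Later.genuine (hl : Later C C') {m : Msg n P H} (hm : S.Genuine C m) : S.Genuine C' m :=
  fun x hx hh => (hm x hx hh).imp fun _ => hl.mem_sent

theorem Reachable.genuine (hC : S.Reachable C) : ∀ m ∈ (C.loc q).log, S.Genuine C m :=
  hC.history_induction q (fun hl h m hm => hl.genuine (h m hm)) (by simp [Local.initial])
    fun _ _ _ hC _ ha ih m hm => (ha.later hC).genuine ((ha.mem_log hm).elim (ih m) id)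

/-- Replica `q` broadcast its vote for `h` in epoch `e` at time `t`. -/
def Voted (C : Config n P H) (q : Fin n) (e : ℕ) (h : H) (t : ℝ) : Prop :=
  (q, .signed q (.vote e h), t) ∈ C.sent

/-- Replica `q` broadcast the block certificate `c` at time `t`. -/
def SentBlockCert (C : Config n P H) (q : Fin n) (c : BlockCert n H) (t : ℝ) : Prop :=
  (q, .quit (.block c), t) ∈ C.sent

/-- Replica `q` broadcast a silence or equivocation certificate of epoch `e` at time `t`. -/
def SentMisbehavior (S : System n P H) (C : Config n P H) (q : Fin n) (e : ℕ) (t : ℝ) : Prop :=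
  ∃ c, S.ValidMisbehavior c ∧ c.epoch = e ∧ (q, .quit c, t) ∈ C.sent

/-- Some honest replica voted for `h` in epoch `e` by time `t`. In contrast to a certificate, this
says something about the past of the execution. -/
def Backed (S : System n P H) (C : Config n P H) (e : ℕ) (h : H) (t : ℝ) : Prop :=
  ∃ r, S.Honest r ∧ ∃ t' ≤ t, Voted C r e h t'

theorem Backed.mono {t' : ℝ} (hb : Backed S C e h t) (hl : Later C C') (ht : t ≤ t') :
    Backed S C' e h t' := by
  obtain ⟨r, hr, u, hu, hv⟩ := hb
  exact ⟨r, hr, u, hu.trans ht, hl.mem_sent hv⟩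

theorem SentMisbehavior.mono (hm : SentMisbehavior S C q e t) (hl : Later C C') :
    SentMisbehavior S C' q e t := by
  obtain ⟨c, hc, he, hs⟩ := hm
  exact ⟨c, hc, he, hl.mem_sent hs⟩

theorem SentMisbehavior.of_lt (hm : SentMisbehavior S C' q e t) (hl : Later C C')
    (ht : t < C.now) : SentMisbehavior S C q e t := by
  obtain ⟨c, hc, he, hs⟩ := hm
  exact ⟨c, hc, he, hl.mem_sent_of_lt hs ht⟩

theorem Reachable.exists_voted_of_mem_log (hC : S.Reachable C) {r : Fin n} (hr : S.Honest r)
    {m : Msg n P H} (hm : m ∈ (C.loc q).log) (hs : (r, .vote e h) ∈ m.sigs) :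
    ∃ t ≤ C.now, Voted C r e h t := by
  obtain ⟨t, ht⟩ := hC.genuine m hm _ hs hr
  exact ⟨t, hC.le_now_of_mem_sent ht, ht⟩

theorem ValidBlockCert.exists_honest (hfaulty : S.faulty.card ≤ S.f) (hc : S.ValidBlockCert c) :
    ∃ r ∈ c.signers, S.Honest r :=
  Finset.exists_mem_notMem_of_card_lt_card (hfaulty.trans_lt hc)

theorem Reachable.backed_of_mem_log (hC : S.Reachable C) (hfaulty : S.faulty.card ≤ S.f)
    (hc : S.ValidBlockCert c) {m : Msg n P H} (hm : m ∈ (C.loc q).log) (hs : c.sigs ⊆ m.sigs) :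
    Backed S C c.epoch c.id C.now := by
  obtain ⟨r, hr, hh⟩ := hc.exists_honest hfaulty
  exact ⟨r, hh, hC.exists_voted_of_mem_log hh hm (hs ⟨hr, rfl⟩)⟩

theorem Reachable.backed_of_hasBlockCert (hC : S.Reachable C) (hfaulty : S.faulty.card ≤ S.f)
    (hc : S.HasBlockCert (C.loc q).log c) : Backed S C c.epoch c.id C.now := by
  rcases hc with ⟨hc, hm | hm⟩
  · exact hC.backed_of_mem_log hfaulty hc hm subset_rfl
  · obtain ⟨r, hr, hh⟩ := hc.exists_honest hfaulty
    exact ⟨r, hh, hC.exists_voted_of_mem_log hh (hm r hr) rfl⟩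

theorem Reachable.validBlockCert_of_sent (hC : S.Reachable C) (hs : SentBlockCert C q c t) :
    S.ValidBlockCert c := by
  obtain ⟨_, _, _, _, _, ha, hm, _, _⟩ := hC.exists_act_of_mem_sent hs
  exact (ha.hasBlockCert_of_quit_mem hm).1

theorem Reachable.backed_of_sentBlockCert (hC : S.Reachable C) (hfaulty : S.faulty.card ≤ S.f)
    (hs : SentBlockCert C q c t) : Backed S C c.epoch c.id t := by
  obtain ⟨_, _, _, hC₀, _, ha, hm, rfl, hl⟩ := hC.exists_act_of_mem_sent hs
  exact (hC₀.backed_of_hasBlockCert hfaulty (ha.hasBlockCert_of_quit_mem hm)).mono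
    ((ha.later hC₀).trans hl) le_rfl

theorem Reachable.backed_locked (hC : S.Reachable C) (hfaulty : S.faulty.card ≤ S.f) :
    (C.loc q).locked = some c → Backed S C c.epoch c.id C.now := by
  refine hC.history_induction q (fun hl h hc => (h hc).mono hl hl.now_le)
    (by simp [Local.initial]) fun C s' out hC _ ha ih hc => ?_
  exact ((ha.locked hc).elim ih (hC.backed_of_hasBlockCert hfaulty)).mono (ha.later hC) le_rfl

theorem Act.backed_locked (ha : Act S C q s' out) (hC : S.Reachable C)
    (hfaulty : S.faulty.card ≤ S.f) (hc : s'.locked = some c) : Backed S C c.epoch c.id C.now :=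
  (ha.locked hc).elim (hC.backed_locked hfaulty) (hC.backed_of_hasBlockCert hfaulty)

theorem Reachable.sentMisbehavior_of_commit_timer (hC : S.Reachable C) :
    ∀ d, (.commit e none, d) ∈ (C.loc q).timers → SentMisbehavior S C q e (d - 2 * S.ΔS) := by
  refine hC.history_induction q (fun hl h d hd => (h d hd).mono hl) (by simp [Local.initial])
    fun C s' out hC _ ha ih d hd => ?_
  rcases ha.commit_none_timer hd with hd | ⟨rfl, c, hc, he, hm⟩
  · exact (ih d hd).mono (ha.later hC)
  · exact ⟨c, hc, he, mem_update_sent.mpr (.inr ⟨rfl, hm, by ring⟩)⟩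

theorem Reachable.sentBlockCert_of_commit_timer (hC : S.Reachable C) :
    ∀ d, (.commit e (some h), d) ∈ (C.loc q).timers →
      ∃ c, c.epoch = e ∧ c.id = h ∧ SentBlockCert C q c (d - 2 * S.ΔS) := by
  refine hC.history_induction q
    (fun hl hd d hτ => (hd d hτ).imp fun _ hc => ⟨hc.1, hc.2.1, hl.mem_sent hc.2.2⟩)
    (by simp [Local.initial]) fun C s' out hC _ ha ih d hd => ?_
  rcases ha.commit_some_timer hd with hd | ⟨rfl, c, he, hi, hm⟩
  · obtain ⟨c, he, hi, hs⟩ := ih d hd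
    exact ⟨c, he, hi, (ha.later hC).mem_sent hs⟩
  · exact ⟨c, he, hi, mem_update_sent.mpr (.inr ⟨rfl, hm, by ring⟩)⟩

theorem Reachable.exists_decides_of_decision (hC : S.Reachable C) :
    (C.loc q).decision e = some h →
      ∃ C₀, S.Reachable C₀ ∧ S.Honest q ∧ Decides S C₀ q e h ∧ Later C₀ C := by
  refine hC.history_induction q (fun hl hd h => ?_) (by simp [Local.initial])
    fun C s' out hC hq ha ih hd => ?_
  · obtain ⟨C₀, hC₀, hq, hd₀, hl₀⟩ := hd h
    exact ⟨C₀, hC₀, hq, hd₀, hl₀.trans hl⟩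
  · rcases ha.decides_of_decision hd with hd | hd
    · obtain ⟨C₀, hC₀, hq, hd₀, hl₀⟩ := ih hd
      exact ⟨C₀, hC₀, hq, hd₀, hl₀.trans (ha.later hC)⟩
    · exact ⟨C, hC, hq, hd, ha.later hC⟩

end History

section SingleVote

variable {e : ℕ} {h h' : H} {t t' : ℝ}

theorem Reachable.epoch_of_voted (hC : S.Reachable C) (hv : Voted C q e h t) :
    (C.loc q).booted ∧ (e < (C.loc q).epoch ∨ (C.loc q).epoch = e ∧ (C.loc q).hasVoted) := by
  obtain ⟨C₀, s', out, hC₀, _, ha, hm, _, hl⟩ := hC.exists_act_of_mem_sent hv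
  have hs : (update C₀ q s' out).loc q = s' := by simp [update_loc]
  obtain ⟨hb, rfl, hvoted⟩ := hs ▸ ha.of_vote_mem hC₀ hm
  refine ⟨hl.booted hb, (hl.epoch_le q).lt_or_eq.imp_right fun he => ⟨he.symm, ?_⟩⟩
  exact hl.hasVoted hvoted he.symm

theorem Reachable.leader_voted (hC : S.Reachable C) (hv : Voted C q e h t) :
    (q, .signed (S.leader e) (.vote e h), t) ∈ C.sent := by
  obtain ⟨C₀, s', out, hC₀, _, ha, hm, rfl, hl⟩ := hC.exists_act_of_mem_sent hv
  exact hl.mem_sent (mem_update_sent.mpr (.inr ⟨rfl, ha.leader_vote_mem hC₀ hm, rfl⟩))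

/-- The leader cannot vote by accepting its own proposal before it has proposed, because its own
vote cannot be forged. -/
theorem Reachable.not_hasVoted_of_epochChange_timer (hC : S.Reachable C) (hq : S.Honest q) :
    ∀ d, (.epochChange (C.loc q).epoch, d) ∈ (C.loc q).timers → ¬ (C.loc q).hasVoted := by
  refine hC.loc_induction q (by simp [Local.initial]) fun C s' out hC ha ih d hd => ?_
  have hle := fun e d => hC.le_epoch_of_epochChange_timer (q := q) (e := e) (d := d)
  cases ha with
  | boot hb => grind [hC.eq_initial_of_not_booted hb, Local.initial]
  | receive => exact ih d hd
  | rule _ _ _ hs =>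
    cases hs with
    | vote b bc hprop hlead hact hvote =>
      rw [hC.leader_eq_of_epochChange_timer hd] at hlead
      obtain ⟨t, -, hv⟩ := hC.exists_voted_of_mem_log hq hlead rfl
      have := hC.epoch_of_voted hv
      grind
    | _ => grind
  | expire τ hτ _ _ _ hs =>
    have := fun e d d' => hC.epochChange_timer_unique (q := q) (e := e) (d := d) (d' := d')
    cases hs <;> grind

theorem Reachable.not_voted_of_vote_mem (hC : S.Reachable C) (hq : S.Honest q)
    (ha : Act S C q s' out) (hm : .signed q (.vote e h) ∈ out) : ¬ Voted C q e h' t' := by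
  intro hv
  have := hC.epoch_of_voted hv
  cases ha with
  | boot => grind
  | receive => grind
  | rule _ _ _ hs => cases hs <;> grind [proposal, enter]
  | expire _ hτ _ _ _ hs =>
    have := hC.not_hasVoted_of_epochChange_timer hq
    cases hs <;> grind [proposal, enter]

theorem Reachable.voted_unique (hC : S.Reachable C) (hv : Voted C q e h t)
    (hv' : Voted C q e h' t') : h = h' := by
  induction hC using Reachable.induction with
  | init => exact hv.elim
  | act C p s' out hC hp ha ih =>
    rcases mem_update_sent.mp hv with hv | ⟨rfl, hm, -⟩ <;>
      rcases mem_update_sent.mp hv' with hv' | ⟨hqp, hm', -⟩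
    · exact ih hv hv'
    · exact absurd hv (hC.not_voted_of_vote_mem (hqp ▸ hp) (hqp ▸ ha) hm')
    · exact absurd hv' (hC.not_voted_of_vote_mem hp ha hm)
    · exact ha.vote_unique hm hm'
  | tick _ _ _ _ ih => exact ih hv hv'

end SingleVote

section Settled

variable {e : ℕ} {h h' : H} {r r' : Fin n} {t t' : ℝ}

theorem Settled.epoch_ne [Nonempty P] (hp : Settled S C p) {c : BlockCert n H}
    (hc : S.HasBlockCert (C.loc p).log c) : c.epoch ≠ (C.loc p).epoch := by
  intro he
  by_cases hact : (C.loc p).status (C.loc p).epoch = some .active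
  · obtain ⟨s', out, hs⟩ := StartEpoch.exists S p C.now ((C.loc p).epoch + 1)
      { C.loc p with
        locked := some c
        timers := insert (.commit (C.loc p).epoch (some c.id), C.now + 2 * S.ΔS)
          (C.loc p).timers }
    exact hp.quiet _ _ (.blockCertActive c hc he hact s' out hs)
  · obtain ⟨s', out, hs⟩ := StartEpoch.exists S p C.now ((C.loc p).epoch + 1)
      { C.loc p with locked := some c }
    exact hp.quiet _ _ (.blockCertInactive c hc he hact s' out hs)

theorem Settled.status_ne_active (hp : Settled S C p) {c : Cert n H}
    (hc : S.HasMisbehavior (C.loc p).log c) : (C.loc p).status c.epoch ≠ some .active := by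
  intro hact
  by_cases he : c.epoch = (C.loc p).epoch
  · exact hp.quiet _ _ (.misbehaviorCurrent c hc he hact)
  · exact hp.quiet _ _ (.misbehaviorOther c hc he hact)

theorem Settled.not_allVotes [Nonempty P] (hp : Settled S C p) (hn : S.f < n) :
    ¬ AllVotes (C.loc p).log (C.loc p).epoch h := fun hall =>
  hp.epoch_ne (c := ⟨(C.loc p).epoch, h, Finset.univ⟩)
    ⟨by simpa [ValidBlockCert] using hn, .inr fun q _ => hall q⟩ rfl

theorem Settled.epoch_ne_of_voted [Nonempty P] (hp : Settled S C p) (hn : 2 * S.f < n)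
    (hfaulty : S.faulty.card ≤ S.f)
    (hv : ∀ r, S.Honest r → ∃ t, t + S.ΔS ≤ C.now ∧ Voted C r e h t) : e ≠ (C.loc p).epoch := by
  refine hp.epoch_ne (c := ⟨e, h, S.faultyᶜ⟩) ⟨?_, .inr fun q hq => ?_⟩
  · simp only [ValidBlockCert, Finset.card_compl, Fintype.card_fin]
    omega
  · obtain ⟨t, ht, hvt⟩ := hv q (by simpa [Honest] using hq)
    exact hp.mem_log hvt ht

theorem Settled.status_ne_active_of_sentMisbehavior (hp : Settled S C p)
    (hm : SentMisbehavior S C r e t) (ht : t + S.ΔS ≤ C.now) :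
    (C.loc p).status e ≠ some .active := by
  obtain ⟨c, hv, rfl, hs⟩ := hm
  exact hp.status_ne_active ⟨hv, .inl (hp.mem_log hs ht)⟩

theorem Settled.status_ne_active_of_votes (hp : Settled S C p) (hne : h ≠ h')
    (hr : (r, .signed (S.leader e) (.vote e h), t) ∈ C.sent) (ht : t + S.ΔS ≤ C.now)
    (hr' : (r', .signed (S.leader e) (.vote e h'), t') ∈ C.sent) (ht' : t' + S.ΔS ≤ C.now) :
    (C.loc p).status e ≠ some .active := by
  refine hp.status_ne_active (c := .equiv (S.leader e) e h h') ⟨⟨rfl, hne⟩, .inr fun x hx => ?_⟩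
  rcases hx with rfl | rfl
  · exact hp.mem_log hr ht
  · exact hp.mem_log hr' ht'

theorem Tick.mem_log (ht : Tick S C t') (hp : S.Honest p) {m : Msg n P H}
    (hm : (r, m, t) ∈ C.sent) (hd : S.deadline m t < t') : m ∈ (C.loc p).log :=
  (ht.deliver hp hm).resolve_right hd.not_ge

theorem Tick.status_ne_active_of_sentMisbehavior (ht' : Tick S C t') (hp : S.Honest p)
    (hb : (C.loc p).booted) (hm : SentMisbehavior S C r e t) (ht : t + S.ΔS < t') :
    (C.loc p).status e ≠ some .active := by
  obtain ⟨c, hv, rfl, hs⟩ := hm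
  exact (ht'.settled hp hb).status_ne_active ⟨hv, .inl (ht'.mem_log hp hs ht)⟩

end Settled

section Synchronization

/-- The assumptions of the hybrid synchronous model on faults, the delay of small messages and the
start of the execution. -/
structure HybridSynchronous (S : System n P H) : Prop where
  two_mul_lt : 2 * S.f < n
  card_faulty_le : S.faulty.card ≤ S.f
  ΔS_pos : 0 < S.ΔS
  start_nonneg : ∀ p, S.Honest p → 0 ≤ S.start p
  start_le : ∀ p q, S.Honest p → S.Honest q → S.start p ≤ S.start q + S.ΔS

/-- Some honest replica has been entitled to start epoch `e` since time `t` or earlier. -/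
inductive Entered (S : System n P H) (C : Config n P H) : ℕ → ℝ → Prop
  | start {r : Fin n} {t : ℝ} (hr : S.Honest r) (ht : S.start r ≤ t) : Entered S C 0 t
  | blockCert {r : Fin n} {c : BlockCert n H} {u t : ℝ} (hs : SentBlockCert C r c u)
      (ht : u ≤ t) : Entered S C (c.epoch + 1) t
  | misbehavior {r : Fin n} {e : ℕ} {u t : ℝ} (hm : SentMisbehavior S C r e u)
      (ht : u + 2 * S.ΔS ≤ t) : Entered S C (e + 1) t

/-- All honest replicas have reached epoch `e`. -/
def AllReached (S : System n P H) (C : Config n P H) (e : ℕ) : Prop :=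
  ∀ q, S.Honest q → (C.loc q).booted ∧ e ≤ (C.loc q).epoch

/-- All honest replicas reach epoch `e` within `ΔS` of the first one, in every execution. -/
def Synchronized (S : System n P H) (e : ℕ) : Prop :=
  ∀ ⦃C t⦄, S.Reachable C → Entered S C e t → t + S.ΔS < C.now → AllReached S C e

variable {e : ℕ} {h : H} {t u : ℝ} {c : BlockCert n H} {r : Fin n}

theorem Entered.mono (h : Entered S C e t) (hl : Later C C') (ht : t ≤ u) : Entered S C' e u := by
  cases h with
  | start hr ht' => exact .start hr (ht'.trans ht)
  | blockCert hs ht' => exact .blockCert (hl.mem_sent hs) (ht'.trans ht)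
  | misbehavior hm ht' => exact .misbehavior (hm.mono hl) (ht'.trans ht)

theorem Entered.of_lt (h : Entered S C' e t) (hΔS : 0 < S.ΔS) (hl : Later C C')
    (ht : t < C.now) : Entered S C e t := by
  cases h with
  | start hr ht' => exact .start hr ht'
  | blockCert hs ht' => exact .blockCert (hl.mem_sent_of_lt hs (ht'.trans_lt ht)) ht'
  | misbehavior hm ht' => exact .misbehavior (hm.of_lt hl (by linarith)) ht'

theorem Entered.nonneg (h : Entered S C e t) (hC : S.Reachable C) (hS : HybridSynchronous S) :
    0 ≤ t := by
  cases h with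
  | start hr ht => exact (hS.start_nonneg _ hr).trans ht
  | blockCert hs ht => exact (hC.nonneg_of_mem_sent hs).trans ht
  | misbehavior hm ht =>
    obtain ⟨c, -, -, hs⟩ := hm
    linarith [hC.nonneg_of_mem_sent hs, hS.ΔS_pos]

theorem AllReached.mono (h : AllReached S C e) (hl : Later C C') : AllReached S C' e :=
  fun q hq => (h q hq).imp hl.booted fun he => he.trans (hl.epoch_le q)

theorem Reachable.entered (hC : S.Reachable C) :
    (C.loc q).booted → Entered S C (C.loc q).epoch C.now := by
  refine hC.history_induction q (fun hl h hb => (h hb).mono hl hl.now_le) (by simp [Local.initial])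
    fun C s' out hC hq ha ih hb => ?_
  cases ha.epochChange with
  | same hb' he => exact he ▸ (ih (hb'.mpr hb)).mono (ha.later hC) le_rfl
  | boot ht he => exact he ▸ .start hq ht.ge
  | blockCert c hc hce he =>
    exact he ▸ hce ▸ .blockCert (mem_update_sent.mpr (.inr ⟨rfl, hc, rfl⟩)) le_rfl
  | misbehavior hτ _ he =>
    exact he ▸ .misbehavior ((hC.sentMisbehavior_of_commit_timer _ hτ).mono (ha.later hC))
      (sub_add_cancel _ _).le

theorem Reachable.entered_of_voted (hC : S.Reachable C) (hv : Voted C q e h t) :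
    Entered S C e t := by
  obtain ⟨C₀, s', out, hC₀, hq, ha, hm, rfl, hl⟩ := hC.exists_act_of_mem_sent hv
  obtain ⟨hb, rfl, -⟩ := ha.of_vote_mem hC₀ hm
  have hs : (update C₀ q s' out).loc q = s' := by simp [update_loc]
  have hent := (hC₀.act hq ha).entered (q := q) (by rwa [hs])
  rw [hs] at hent
  exact hent.mono hl le_rfl

theorem Reachable.entered_of_sentMisbehavior (hC : S.Reachable C)
    (hm : SentMisbehavior S C q e t) : Entered S C e t := by
  obtain ⟨c, hc, rfl, hs⟩ := hm
  obtain ⟨C₀, s', out, hC₀, _, ha, hm, rfl, hl⟩ := hC.exists_act_of_mem_sent hs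
  obtain ⟨hb, he, -⟩ := ha.of_quit_mem hc hm
  exact he ▸ (hC₀.entered hb).mono ((ha.later hC₀).trans hl) le_rfl

theorem Reachable.entered_of_sentBlockCert (hC : S.Reachable C) (hfaulty : S.faulty.card ≤ S.f)
    (hs : SentBlockCert C q c t) : Entered S C c.epoch t := by
  obtain ⟨r, -, u, hu, hv⟩ := hC.backed_of_sentBlockCert hfaulty hs
  exact (hC.entered_of_voted hv).mono (.refl _) hu

theorem Reachable.entered_pred (hC : S.Reachable C) (hS : HybridSynchronous S)
    (h : Entered S C (e + 1) t) : Entered S C e t := by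
  cases h with
  | blockCert hs ht => exact (hC.entered_of_sentBlockCert hS.card_faulty_le hs).mono (.refl _) ht
  | misbehavior hm ht =>
    exact (hC.entered_of_sentMisbehavior hm).mono (.refl _) (by linarith [hS.ΔS_pos])

theorem synchronized_zero (hS : HybridSynchronous S) : Synchronized S 0 := by
  intro C t hC hent ht q hq
  obtain ⟨C₀, t', _, htick, hlt, hl⟩ := hC.exists_tick
    (add_nonneg (hent.nonneg hC hS) hS.ΔS_pos.le) ht
  refine ⟨hl.booted ?_, zero_le⟩
  by_contra hb
  cases hent with
  | start hr hrt => linarith [htick.start hq hb, hS.start_le q _ hq hr]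

theorem Synchronized.status_ne_active (he : Synchronized S e) (hC : S.Reachable C)
    (hS : HybridSynchronous S) (hm : SentMisbehavior S C r e t) (ht : t + S.ΔS < C.now)
    (hq : S.Honest q) : (C.loc q).status e ≠ some .active := by
  have hent := hC.entered_of_sentMisbehavior hm
  obtain ⟨C₀, t', hC₀, htick, hlt, hl⟩ := hC.exists_tick
    (add_nonneg (hent.nonneg hC hS) hS.ΔS_pos.le) ht
  have htt' : t < t' := by linarith [hS.ΔS_pos]
  obtain ⟨hb, hle⟩ := he (hC₀.tick htick) (hent.of_lt hS.ΔS_pos hl htt') hlt q hq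
  have hm₀ := hm.of_lt hl htt'
  exact hl.status_ne_active hb hle (htick.status_ne_active_of_sentMisbehavior hq hb hm₀ hlt)

theorem Synchronized.sentMisbehavior_le (he : Synchronized S e) (hC : S.Reachable C)
    (hS : HybridSynchronous S) (hm : SentMisbehavior S C r e t) (hm' : SentMisbehavior S C q e u) :
    u ≤ t + S.ΔS := by
  obtain ⟨c, hc, rfl, hs⟩ := hm'
  obtain ⟨C₀, s', out, hC₀, hq, ha, hout, rfl, hl⟩ := hC.exists_act_of_mem_sent hs
  by_contra! hlt
  have hm₀ := hm.of_lt ((ha.later hC₀).trans hl) (by linarith [hS.ΔS_pos])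
  exact he.status_ne_active hC₀ hS hm₀ hlt hq (ha.of_quit_mem hc hout).2.2

/-- A replica that gives up epoch `e` waits for `2ΔS`, and all replicas that give up `e` begin to
wait within `ΔS` of each other. -/
theorem Synchronized.epoch_ne_of_sentMisbehavior [Nonempty P] (he : Synchronized S e)
    (hC : S.Reachable C) (hS : HybridSynchronous S) {t' : ℝ} (ht' : Tick S C t')
    (hm : SentMisbehavior S C r e t) (ht : t + 3 * S.ΔS < t') (hq : S.Honest q)
    (hb : (C.loc q).booted) : (C.loc q).epoch ≠ e := by
  rintro rfl
  have hact := ht'.status_ne_active_of_sentMisbehavior hq hb hm (by linarith [hS.ΔS_pos])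
  match hst : (C.loc q).status (C.loc q).epoch with
  | none => exact hC.status_epoch_ne_none hb hst
  | some .active => exact hact hst
  | some .committed =>
    obtain ⟨h, hall⟩ := hC.exists_allVotes_of_committed hst
    exact (ht'.settled hq hb).not_allVotes (by linarith [hS.two_mul_lt]) hall
  | some .notCommitted =>
    obtain ⟨d, hd⟩ := hC.exists_commit_timer_of_notCommitted hst
    linarith [ht'.timer hq hd,
      he.sentMisbehavior_le hC hS hm (hC.sentMisbehavior_of_commit_timer d hd)]

theorem Synchronized.succ [Nonempty P] (he : Synchronized S e) (hS : HybridSynchronous S) :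
    Synchronized S (e + 1) := by
  intro C t hC hent ht
  obtain ⟨C₀, t', hC₀, htick, hlt, hl⟩ := hC.exists_tick
    (add_nonneg (hent.nonneg hC hS) hS.ΔS_pos.le) ht
  have hC₁ := hC₀.tick htick
  replace hent := hent.of_lt hS.ΔS_pos hl (lt_of_lt_of_le (by linarith [hS.ΔS_pos]) hlt.le)
  refine AllReached.mono (fun q hq => ?_) hl
  obtain ⟨hb, hle⟩ := he hC₁ (hC₁.entered_pred hS hent) hlt q hq
  refine ⟨hb, hle.lt_of_ne' ?_⟩
  cases hent with
  | @blockCert r c u _ hs hu =>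
    have hlog : .quit (.block c) ∈ (C₀.loc q).log :=
      htick.mem_log hq hs ((add_le_add_left hu S.ΔS).trans_lt hlt)
    exact ((htick.settled hq hb).epoch_ne ⟨hC₁.validBlockCert_of_sent hs, .inl hlog⟩).symm
  | misbehavior hm hu =>
    exact he.epoch_ne_of_sentMisbehavior (C := C₀) hC₀ hS htick hm (by linarith) hq hb

theorem HybridSynchronous.synchronized [Nonempty P] (hS : HybridSynchronous S) :
    ∀ e, Synchronized S e
  | 0 => synchronized_zero hS
  | e + 1 => (hS.synchronized e).succ hS

theorem Reachable.voted_le_of_sentBlockCert [Nonempty P] (hC : S.Reachable C)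
    (hS : HybridSynchronous S) (hc : SentBlockCert C r c u) (hv : Voted C q c.epoch h t) :
    t ≤ u + S.ΔS := by
  obtain ⟨C₀, s', out, hC₀, hq, ha, hm, rfl, hl⟩ := hC.exists_act_of_mem_sent hv
  by_contra! hlt
  have hc₀ : SentBlockCert C₀ r c u :=
    ((ha.later hC₀).trans hl).mem_sent_of_lt hc (by linarith [hS.ΔS_pos])
  have hreached := hS.synchronized (c.epoch + 1) hC₀ (.blockCert hc₀ le_rfl) hlt q hq
  have := ha.epoch_le hC₀
  have := (ha.of_vote_mem hC₀ hm).2.1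
  omega

end Synchronization

section Decisions

variable {e e' : ℕ} {h h' : H} {t T : ℝ}

/-- By time `T`, an honest replica broadcast a block certificate of epoch `e`, or all honest
replicas voted for the same hash in epoch `e`, so that at time `T + ΔS` every honest replica has a
block certificate of `e`. -/
def Certified (S : System n P H) (C : Config n P H) (e : ℕ) (T : ℝ) : Prop :=
  (∃ r c, c.epoch = e ∧ ∃ t ≤ T, SentBlockCert C r c t) ∨
    ∃ h, ∀ r, S.Honest r → ∃ t ≤ T, Voted C r e h t

/-- Some honest replica may have left epoch `e` without a block certificate of this epoch. -/
def Skipped (S : System n P H) (C : Config n P H) (e : ℕ) : Prop :=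
  ∃ q t, SentMisbehavior S C q e t ∧ t + 2 * S.ΔS ≤ C.now ∧ ¬ Certified S C e (t + S.ΔS)

theorem Certified.mono (hc : Certified S C e T) (hl : Later C C') (hT : T ≤ t) :
    Certified S C' e t := by
  rcases hc with ⟨r, c, he, u, hu, hs⟩ | ⟨h, hv⟩
  · exact .inl ⟨r, c, he, u, hu.trans hT, hl.mem_sent hs⟩
  · exact .inr ⟨h, fun r hr => (hv r hr).imp fun _ hu => ⟨hu.1.trans hT, hl.mem_sent hu.2⟩⟩

theorem Certified.of_lt (hc : Certified S C' e T) (hl : Later C C') (hT : T < C.now) :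
    Certified S C e T := by
  rcases hc with ⟨r, c, he, t, ht, hs⟩ | ⟨h, hv⟩
  · exact .inl ⟨r, c, he, t, ht, hl.mem_sent_of_lt hs (ht.trans_lt hT)⟩
  · refine .inr ⟨h, fun r hr => ?_⟩
    obtain ⟨t, ht, hvt⟩ := hv r hr
    exact ⟨t, ht, hl.mem_sent_of_lt hvt (ht.trans_lt hT)⟩

theorem Skipped.mono (hs : Skipped S C e) (hΔS : 0 < S.ΔS) (hl : Later C C') :
    Skipped S C' e := by
  obtain ⟨q, t, hm, ht, hc⟩ := hs
  exact ⟨q, t, hm.mono hl, ht.trans hl.now_le, fun hc' => hc (hc'.of_lt hl (by linarith))⟩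

theorem Settled.not_certified [Nonempty P] (hp : Settled S C p) (hC : S.Reachable C)
    (hn : 2 * S.f < n) (hfaulty : S.faulty.card ≤ S.f) :
    ¬ Certified S C (C.loc p).epoch (C.now - S.ΔS) := by
  rintro (⟨r, c, he, t, ht, hs⟩ | ⟨h, hv⟩)
  · exact hp.epoch_ne ⟨hC.validBlockCert_of_sent hs,
      .inl (hp.mem_log hs (by simp only [deadline]; linarith))⟩ he
  · refine hp.epoch_ne_of_voted hn hfaulty (h := h) (fun r hr => ?_) rfl
    obtain ⟨t, ht, hvt⟩ := hv r hr
    exact ⟨t, by linarith, hvt⟩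

theorem Reachable.skipped_or_locked [Nonempty P] (hC : S.Reachable C) (hn : 2 * S.f < n)
    (hfaulty : S.faulty.card ≤ S.f) (hΔS : 0 < S.ΔS) : e < (C.loc q).epoch →
      Skipped S C e ∨ ∃ l, (C.loc q).locked = some l ∧ e ≤ l.epoch := by
  refine hC.history_induction q (fun hl ih he => (ih he).imp_left (·.mono hΔS hl))
    (by simp [Local.initial]) fun C s' out hC _ ha ih he => ?_
  refine Or.imp_left (Skipped.mono · hΔS (ha.later hC)) ?_
  cases ha.epochChange with
  | same _ he' hl =>
    have := ih (he' ▸ he)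
    grind
  | boot ht he' => omega
  | blockCert c hc hce he' hl => exact .inr ⟨c, hl, by omega⟩
  | misbehavior hτ hset he' hl =>
    rw [hl]
    rcases (show e ≤ (C.loc q).epoch by omega).lt_or_eq with hlt | rfl
    · exact ih hlt
    · refine .inl ⟨q, _, hC.sentMisbehavior_of_commit_timer _ hτ, (sub_add_cancel _ _).le, ?_⟩
      rw [show C.now - 2 * S.ΔS + S.ΔS = C.now - S.ΔS by ring]
      exact hset.not_certified hC hn hfaulty

theorem HybridSynchronous.exists_honest (hS : HybridSynchronous S) : ∃ r, S.Honest r := by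
  obtain ⟨r, -, hr⟩ := Finset.exists_mem_notMem_of_card_lt_card
    (s := S.faulty) (t := Finset.univ) (by
      simpa using hS.card_faulty_le.trans_lt (by linarith [hS.two_mul_lt]))
  exact ⟨r, hr⟩

theorem Decides.exists_voted (hd : Decides S C p e h) (hC : S.Reachable C)
    (hS : HybridSynchronous S) : ∃ r t, Voted C r e h t := by
  rcases hd.allVotes_or_expired with hall | ⟨hτ, -⟩
  · obtain ⟨r, hr⟩ := hS.exists_honest
    obtain ⟨t, -, hv⟩ := hC.exists_voted_of_mem_log hr (hall r) rfl
    exact ⟨r, t, hv⟩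
  · obtain ⟨c, rfl, rfl, hs⟩ := hC.sentBlockCert_of_commit_timer _ hτ
    obtain ⟨r, -, t, -, hv⟩ := hC.backed_of_sentBlockCert hS.card_faulty_le hs
    exact ⟨r, t, hv⟩

/-- The regular commit rule waits long enough to learn of an equivocation of the leader before it
decides. -/
theorem Decides.eq_of_voted [Nonempty P] (hd : Decides S C p e h) (hC : S.Reachable C)
    (hS : HybridSynchronous S) (hl : Later C C') (hC' : S.Reachable C')
    (hv : Voted C' q e h' t) : h' = h := by
  rcases hd.allVotes_or_expired with hall | ⟨hτ, hset⟩
  · obtain ⟨u, -, hvu⟩ := hC.exists_voted_of_mem_log (hC'.honest_of_mem_sent hv) (hall q) rfl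
    exact hC'.voted_unique hv (hl.mem_sent hvu)
  · obtain ⟨c, rfl, rfl, hs⟩ := hC.sentBlockCert_of_commit_timer _ hτ
    obtain ⟨r, -, u, hu, hvu⟩ := hC.backed_of_sentBlockCert hS.card_faulty_le hs
    have ht := hC'.voted_le_of_sentBlockCert hS (hl.mem_sent hs) hv
    have hΔS := hS.ΔS_pos
    have hv₀ : Voted C q c.epoch h' t := hl.mem_sent_of_lt hv (by linarith)
    by_contra hne
    exact hset.status_ne_active_of_votes hne (hC.leader_voted hv₀) (by linarith)
      (hC.leader_voted hvu) (by linarith) hd.active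

theorem Decides.certified [Nonempty P] (hd : Decides S C p e h) (hp : S.Honest p)
    (hC : S.Reachable C) (hS : HybridSynchronous S) (hl : Later C C')
    (hm : SentMisbehavior S C' q e t) : Certified S C' e (t + S.ΔS) := by
  have hΔS := hS.ΔS_pos
  rcases hd.allVotes_or_expired with hall | ⟨hτ, hset⟩
  · suffices hle : C.now ≤ t + S.ΔS from
      (show Certified S C e C.now from
        .inr ⟨h, fun r hr => hC.exists_voted_of_mem_log hr (hall r) rfl⟩).mono hl hle
    by_contra! hlt
    exact (hS.synchronized e).status_ne_active hC hS (hm.of_lt hl (by linarith)) hlt hp hd.active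
  · obtain ⟨c, rfl, rfl, hs⟩ := hC.sentBlockCert_of_commit_timer _ hτ
    refine .inl ⟨p, c, rfl, _, ?_, hl.mem_sent hs⟩
    by_contra! hlt
    exact hset.status_ne_active_of_sentMisbehavior (hm.of_lt hl (by linarith)) (by linarith)
      hd.active

theorem Decides.not_skipped [Nonempty P] (hd : Decides S C p e h) (hp : S.Honest p)
    (hC : S.Reachable C) (hS : HybridSynchronous S) (hl : Later C C') :
    ¬ Skipped S C' e := by
  rintro ⟨q, t, hm, -, hc⟩
  exact hc (hd.certified hp hC hS hl hm)

/-- `h` and `h'` are the hashes of blocks of which the second extends the first. -/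
def Extends (S : System n P H) (h h' : H) : Prop :=
  ∃ a b, S.hash a = h ∧ S.hash b = h' ∧ Ancestor S.hash a b

theorem Act.exists_backed_prev [Nonempty P] (ha : Act S C p s' out) (hC : S.Reachable C)
    (hp : S.Honest p) (hS : HybridSynchronous S) (hm : .signed p (.vote e' h') ∈ out)
    (he : e < e') (hskip : ¬ Skipped S (update C p s' out) e) :
    ∃ (b : Block P H) (c : BlockCert n H), h' = S.hash b ∧ b.prev = some c.id ∧ e ≤ c.epoch ∧
      Backed S C c.epoch c.id C.now := by
  have hC' := hC.act hp ha
  have hs : (update C p s' out).loc p = s' := by simp [update_loc]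
  obtain ⟨hn, hfaulty, hΔS⟩ : 2 * S.f < n ∧ S.faulty.card ≤ S.f ∧ 0 < S.ΔS :=
    ⟨hS.two_mul_lt, hS.card_faulty_le, hS.ΔS_pos⟩
  obtain ⟨b, hb, hprev | ⟨bc, hprop, rfl, -, hvalid, hprev, hlock⟩⟩ :=
    ha.exists_block_of_vote_mem hm
  · obtain ⟨l, hl, hle⟩ := (hC'.skipped_or_locked (q := p) hn hfaulty hΔS
      (by rwa [hs, (ha.of_vote_mem hC hm).2.1])).resolve_left hskip
    rw [hs] at hl
    exact ⟨b, l, hb, by rw [hprev, hl]; rfl, hle, ha.backed_locked hC hfaulty hl⟩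
  · obtain ⟨l, hl, hle⟩ := (hC.skipped_or_locked hn hfaulty hΔS he).resolve_left
      fun h => hskip (h.mono hΔS (ha.later hC))
    obtain hnone | ⟨l', c, hl', rfl, hlc⟩ := hlock
    · simp [hl] at hnone
    · obtain rfl : l = l' := by simpa [hl] using hl'
      exact ⟨b, c, hb, hprev, hle.trans hlc, hC.backed_of_mem_log hfaulty (hvalid c rfl) hprop
        fun x hx => ⟨c, rfl, hx⟩⟩

theorem Reachable.extends_of_voted [Nonempty P] (hC : S.Reachable C) (hS : HybridSynchronous S)
    (huniq : ∀ q h' t, Voted C q e h' t → h' = h) (hskip : ¬ Skipped S C e)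
    (hv : Voted C q e' h' t) (hle : e ≤ e') : Extends S h h' := by
  induction hC using Reachable.induction generalizing q e' h' t with
  | init => exact hv.elim
  | act C p s' out hC hp ha ih =>
    have hlater := ha.later hC
    replace ih {q e' h' t} := ih (q := q) (e' := e') (h' := h') (t := t)
      (fun q h' t hv => huniq q h' t (hlater.mem_sent hv))
      fun h => hskip (h.mono hS.ΔS_pos hlater)
    rcases mem_update_sent.mp hv with hv' | ⟨rfl, hm, rfl⟩
    · exact ih hv' hle
    rcases hle.lt_or_eq with hlt | rfl
    · obtain ⟨b, c, rfl, hbc, hec, r, -, u, -, hvu⟩ :=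
        ha.exists_backed_prev hC hp hS hm hlt hskip
      obtain ⟨b₀, b₁, rfl, hb₁, hanc⟩ := ih hvu hec
      exact ⟨b₀, b, rfl, rfl, hanc.tail (by rw [Parent, hbc, hb₁])⟩
    · obtain ⟨b, rfl, -⟩ := ha.exists_block_of_vote_mem hm
      exact ⟨b, b, huniq q _ _ hv, rfl, .refl⟩
  | tick _ _ _ ht ih =>
    exact ih huniq (fun h => hskip (h.mono hS.ΔS_pos ht.later)) hv hle

theorem Reachable.ancestor_of_decision [Nonempty P] (hC : S.Reachable C)
    (hS : HybridSynchronous S) (hhash : Function.Injective S.hash) {d d' : Block P H}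
    (hd : (C.loc p).decision e = some (S.hash d)) (hd' : (C.loc q).decision e' = some (S.hash d'))
    (hle : e ≤ e') : Ancestor S.hash d d' := by
  obtain ⟨C₀, hC₀, hp, hdec, hl⟩ := hC.exists_decides_of_decision hd
  obtain ⟨C₁, hC₁, -, hdec', hl'⟩ := hC.exists_decides_of_decision hd'
  obtain ⟨r, t, hv⟩ := hdec'.exists_voted hC₁ hS
  obtain ⟨b, b', hb, hb', hanc⟩ := hC.extends_of_voted hS
    (fun _ _ _ hv => hdec.eq_of_voted hC₀ hS hl hC hv) (hdec.not_skipped hp hC₀ hS hl)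
    (hl'.mem_sent hv) hle
  rwa [hhash hb, hhash hb'] at hanc

theorem Reachable.exists_decision_of_hasCommitted (hC : S.Reachable C) {b : Block P H}
    (hb : S.HasCommitted C p b) :
    ∃ e d, (C.loc p).decision e = some (S.hash d) ∧ Ancestor S.hash b d :=
  hb.elim hC.exists_decision_of_mem_ledger id

end Decisions

end System

end AlterBFT

theorem mainTheorem1 {n : ℕ} {P H : Type*} (S : AlterBFT.System n P H)
    (hn : 2 * S.f < n) (hfaulty : S.faulty.card ≤ S.f)
    (hhash : Function.Injective S.hash)
    (hΔS : 0 < S.ΔS) (hΔL : 0 < S.ΔL)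
    (hstart : ∀ p, S.Honest p → 0 ≤ S.start p)
    (hsync : ∀ p q, S.Honest p → S.Honest q → S.start p ≤ S.start q + S.ΔS)
    (C : AlterBFT.Config n P H) (hC : S.Reachable C)
    (p q : Fin n) (hp : S.Honest p) (hq : S.Honest q)
    (b b' : AlterBFT.Block P H) (k : ℕ)
    (hb : AlterBFT.System.HasCommitted S C p b) (hb' : AlterBFT.System.HasCommitted S C q b')
    (hk : AlterBFT.HasHeight S.hash b k) (hk' : AlterBFT.HasHeight S.hash b' k) :
    b = b' := by
  have hS : S.HybridSynchronous := ⟨hn, hfaulty, hΔS, hstart, hsync⟩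
  have : Nonempty P := ⟨b.payload⟩
  obtain ⟨e, d, hd, hbd⟩ := hC.exists_decision_of_hasCommitted hb
  obtain ⟨e', d', hd', hbd'⟩ := hC.exists_decision_of_hasCommitted hb'
  rcases le_total e e' with hle | hle
  · have hdd : AlterBFT.Ancestor S.hash d d' := hC.ancestor_of_decision hS hhash hd hd' hle
    exact AlterBFT.eq_of_ancestor_of_hasHeight hhash (hbd.trans hdd) hbd' hk hk'
  · have hdd : AlterBFT.Ancestor S.hash d' d := hC.ancestor_of_decision hS hhash hd' hd hle
    exact AlterBFT.eq_of_ancestor_of_hasHeight hhash hbd (hbd'.trans hdd) hk hk'
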